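/- Let $M_1,\dots,M_d\ge 0$ be integers, $\mathcal M=\{m\in\mathbb Z^d:0\le m_i\le M_i\}$, $n=|\mathcal M|$, and let $x_0\in\mathbb C^{\mathcal M}\cong\mathbb C^n$ be a fixed object of rank $\ge 2$, i.e. the convex hull of its support $\{m\in\mathcal M: x_0(m)\neq 0\}$ in $\mathbb R^d$ has dimension at least two (so $d\ge 2$). Let $\Phi$ be the oversampled discrete Fourier transform, $\Phi(w,m)=e^{-2\pi i\, m\cdot w}$, with $m\in\mathcal M$ and frequencies $w$ in the grid $\{w: w_i\in\{0,\tfrac1{2M_i+1},\dots,\tfrac{2M_i}{2M_i+1}\}\}$. Let $\ell\ge 2$ and let $\mu_1,\dots,\mu_\ell$ be phase masks on $\mathcal M$ (random or deterministic, $|\mu_j(m)|=1$) such that for at least one index $j_0$ the entries $\mu_{j_0}(m)$, $m\in\mathcal M$, are independent random variables with continuous (atomless) distributions on the unit circle, and such that each of the other masks is independent of $\mu_{j_0}$. Let $$A^*=c\begin{bmatrix}\Phi\,\mathrm{diag}\{\mu_1\}\\ \vdots\\ \Phi\,\mathrm{diag}\{\mu_\ell\}\end{bmatrix}\in\mathbb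 C^{N\times n},$$ where the constant $c$ is chosen so that $A^*$ is isometric, i.e. $AA^*=I$. Put $b=|A^*x_0|$ (componentwise). An FDR (Fourier-domain Douglas--Rachford) sequence is a sequence $y^{(1)},y^{(2)},\dots$ in $\mathbb C^N$ with $$y^{(k+1)}=y^{(k)}+A^*A\Big(2b\odot\frac{y^{(k)}}{|y^{(k)}|}-y^{(k)}\Big)-b\odot\frac{y^{(k)}}{|y^{(k)}|},\qquad k\ge 1,$$ where products and quotients are componentwise and $z/|z|:=1$ at $z=0$. Write $x^{(k)}:=Ay^{(k)}$ and $$\alpha^{(k)}:=\arg\min\{\|\alpha x^{(k)}-x_0\|:\alpha\in\mathbb C,\ |\alpha|=1\}.$$ Then with probability one there are constants $0\le\gamma<1$ and $\delta>0$ such that the following hold. 1. For every FDR sequence started from an object estimate $x^{(1)}$, i.e. from $y^{(1)}=A^*x^{(1)}$, with $\|x^{(1)}-x_0\|<\delta$, $$\|\alpha^{(k)}x^{(k)}-x_0\|\le\gamma^{k-1}\|x^{(1)}-x_0\|\qquad\text{for all }k\ge 1.$$ 2. For every FDR sequence with arbitrary initial vector $y^{(1)}\in\mathbb C^N$ satisfying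 $\|y^{(1)}-A^*x_0\|<\delta$, $$\|\alpha^{(k)}x^{(k)}-x_0\|\le\gamma^{k-1}\|y^{(1)}-A^*x_0\|\qquad\text{for all }k\ge 1.$$ -/

import Mathlib

open Matrix MeasureTheory ProbabilityTheory

noncomputable section

/-- Pixels of the `d`-dimensional object grid `{n ∈ ℤ^d : 0 ≤ n_i ≤ M_i}`. -/
abbrev ObjGrid {d : ℕ} (M : Fin d → ℕ) : Type := (i : Fin d) → Fin (M i + 1)

/-- Indices of the oversampled frequencies `w_i = p_i / (2 M_i + 1)`, `0 ≤ p_i ≤ 2 M_i`. -/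
abbrev FreqGrid {d : ℕ} (M : Fin d → ℕ) : Type := (i : Fin d) → Fin (2 * M i + 1)

/-- The support of an object, as a set of points of `ℝ^d`. -/
def objSupport {d : ℕ} {M : Fin d → ℕ} (x : EuclideanSpace ℂ (ObjGrid M)) :
    Set (Fin d → ℝ) :=
  (fun (n : ObjGrid M) (i : Fin d) => ((n i : ℕ) : ℝ)) '' {n | x n ≠ 0}

/-- Rank `≥ 2`: the convex hull of the support has (affine) dimension at least two. -/
def RankGeTwo {d : ℕ} {M : Fin d → ℕ} (x : EuclideanSpace ℂ (ObjGrid M)) : Prop :=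
  2 ≤ Module.finrank ℝ (vectorSpan ℝ (convexHull ℝ (objSupport x)))

/-- The oversampled discrete Fourier transform `Φ`, with entries `exp (-2πi n·w)`. -/
def oversampledDFT {d : ℕ} (M : Fin d → ℕ) : Matrix (FreqGrid M) (ObjGrid M) ℂ :=
  Matrix.of fun p n =>
    Complex.exp (-(2 * Real.pi * Complex.I *
      ∑ i, ((n i : ℕ) : ℂ) * (((p i : ℕ) : ℂ) / (2 * (M i : ℂ) + 1))))

/-- The propagation matrix `A^*`: the blocks `c Φ diag(μ_j)`, `j = 1, …, ℓ`, stacked on top of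
each other. -/
def propagation {d ℓ : ℕ} (M : Fin d → ℕ) (c : ℂ) (μ : Fin ℓ → ObjGrid M → ℂ) :
    Matrix (Fin ℓ × FreqGrid M) (ObjGrid M) ℂ :=
  Matrix.of fun r n => (c • (oversampledDFT M * Matrix.diagonal (μ r.1))) r.2 n

/-- The matrix `T` has orthonormal columns. -/
def IsIsometric {κ ι : Type*} [Fintype κ] [DecidableEq ι] (T : Matrix κ ι ℂ) : Prop :=
  Tᴴ * T = 1

/-- The phase `z / |z|`, equal to `1` at `z = 0`. -/
def phase (z : ℂ) : ℂ := if z = 0 then 1 else z / (‖z‖ : ℂ)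

/-- `b ⊙ (y / |y|)`. -/
def fitData {κ : Type*} (b : κ → ℝ) (y : EuclideanSpace ℂ κ) : EuclideanSpace ℂ κ :=
  WithLp.toLp 2 fun j => (b j : ℂ) * phase (y j)

/-- The Fourier-domain Douglas–Rachford map
`y ↦ y + A^* A (2 b ⊙ y/|y| - y) - b ⊙ y/|y|`, where `T` is `A^*`, so that `A = Tᴴ`. -/
def fdrMap {κ ι : Type*} [Fintype κ] [DecidableEq κ] [Fintype ι] [DecidableEq ι]
    (T : Matrix κ ι ℂ) (b : κ → ℝ) (y : EuclideanSpace ℂ κ) : EuclideanSpace ℂ κ :=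
  y + T.toEuclideanLin (Tᴴ.toEuclideanLin ((2 : ℂ) • fitData b y - y)) - fitData b y

/-- The data `b = |A^* x₀|`, where `T` is `A^*`. -/
def magnitudes {κ ι : Type*} [Fintype ι] [DecidableEq ι]
    (T : Matrix κ ι ℂ) (x₀ : EuclideanSpace ℂ ι) (j : κ) : ℝ :=
  ‖T.toEuclideanLin x₀ j‖

/-- `y 1, y 2, …` is an FDR sequence for the data `|A^* x₀|`, where `T` is `A^*`. The value `y 0`
plays no role. -/
def IsFDRSequence {κ ι : Type*} [Fintype κ] [DecidableEq κ] [Fintype ι] [DecidableEq ι]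
    (T : Matrix κ ι ℂ) (x₀ : EuclideanSpace ℂ ι) (y : ℕ → EuclideanSpace ℂ κ) : Prop :=
  ∀ k : ℕ, 1 ≤ k → y (k + 1) = fdrMap T (magnitudes T x₀) (y k)

/-- `α` minimizes `‖α x - x₀‖` among the complex numbers of modulus one. -/
def IsOptimalPhase {ι : Type*} [Fintype ι] (x x₀ : EuclideanSpace ℂ ι) (α : ℂ) : Prop :=
  ‖α‖ = 1 ∧ ∀ β : ℂ, ‖β‖ = 1 → ‖α • x - x₀‖ ≤ ‖β • x - x₀‖

end

/-! Write y₀ = A*x₀, P = A*A, and let τ be the tangential projection at y₀. The linear part of the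
map at y₀ is J = (1-P)(1-τ) + Pτ, and Pythagoras gives ‖u‖² - ‖Ju‖² = ‖P(1-τ)u‖² + ‖(1-P)τu‖². So J
preserves the norm of u only if τu is in the range of A* and (1-τ)u is in ker A. Suppose the phases
are rigid (`HasRigidPhase`): a vector in the range of A* whose quotients by y₀ are purely imaginary
is a real multiple of iy₀. Then J is strictly contracting off two neutral families: the global phase
iy₀, and W = ker A ∩ ker τ (`fixedDir`), along which y₀ + w is again a fixed point for small w.

Progress is therefore measured by ‖Q(αy - y₀)‖, where Q projects orthogonally off W and α is the
best phase. The remainder at y₀ + w is O((‖w‖+‖u‖)‖u‖), and optimality of α makes u almost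
orthogonal to iy₀, so this quantity contracts by a uniform factor. The drift along W is summable, so
the iterates stay near y₀; and A annihilates W, so the object error is controlled
(`IsIsometric.exists_fdr_convergence`).

Rigidity holds almost surely by a genericity argument on the mask j₀ and one other mask ν. With u
and its conjugate treated as independent unknowns, the phase condition is a complex-linear system
whose coefficients are polynomial in the first mask once denominators are cleared. Independent
atomless entries avoid the zero set of a nonzero polynomial, so for each ν one good first mask
suffices. It is found by altering ν at one extreme pixel: oversampling turns the relations into
polynomial identities, and if every alteration failed, extreme coefficients would force the
generating polynomial of the masked object to be a binomial (`exists_unique_mask`). Rank at least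
two gives three support pixels, a contradiction. -/

set_option linter.unusedSectionVars false

/-! ### Real inner products and isometric matrices -/

section RealInner

variable {κ : Type*} [Fintype κ]

theorem real_inner_eq_re_inner_euclidean (u v : EuclideanSpace ℂ κ) :
    inner ℝ u v = (inner ℂ u v).re := by
  simp [PiLp.inner_apply, Complex.inner]

theorem real_inner_euclidean_I_smul_self (u : EuclideanSpace ℂ κ) :
    inner ℝ u (Complex.I • u) = 0 := by
  rw [real_inner_eq_re_inner_euclidean, inner_smul_right, inner_self_eq_norm_sq_to_K]
  simp [← Complex.ofReal_pow]

end RealInner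

section Isometric

variable {κ ι : Type*} [Fintype κ] [DecidableEq κ] [Fintype ι] [DecidableEq ι]
  {T : Matrix κ ι ℂ}

theorem inner_conjTranspose_apply (T : Matrix κ ι ℂ) (v : EuclideanSpace ℂ κ)
    (x : EuclideanSpace ℂ ι) :
    inner ℂ (Tᴴ.toEuclideanLin v) x = inner ℂ v (T.toEuclideanLin x) := by
  rw [toEuclideanLin_conjTranspose_eq_adjoint, LinearMap.adjoint_inner_left]

theorem IsIsometric.conjTranspose_apply_apply (hT : IsIsometric T) (x : EuclideanSpace ℂ ι) :
    Tᴴ.toEuclideanLin (T.toEuclideanLin x) = x := by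
  ext i
  have h : Tᴴ *ᵥ (T *ᵥ x.ofLp) = x.ofLp := by
    rw [Matrix.mulVec_mulVec, hT, Matrix.one_mulVec]
  simpa [Matrix.toLpLin_apply] using congrFun h i

theorem IsIsometric.norm_apply (hT : IsIsometric T) (x : EuclideanSpace ℂ ι) :
    ‖T.toEuclideanLin x‖ = ‖x‖ := by
  have h : inner ℂ (T.toEuclideanLin x) (T.toEuclideanLin x) = inner ℂ x x := by
    rw [← inner_conjTranspose_apply, hT.conjTranspose_apply_apply]
  rw [inner_self_eq_norm_sq_to_K, inner_self_eq_norm_sq_to_K] at h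
  have h' : ‖T.toEuclideanLin x‖ ^ 2 = ‖x‖ ^ 2 := by exact_mod_cast h
  exact (sq_eq_sq₀ (norm_nonneg _) (norm_nonneg _)).1 h'

theorem real_inner_apply_of_conjTranspose_eq_zero {v : EuclideanSpace ℂ κ}
    (hv : Tᴴ.toEuclideanLin v = 0) (x : EuclideanSpace ℂ ι) :
    inner ℝ v (T.toEuclideanLin x) = 0 := by
  rw [real_inner_eq_re_inner_euclidean, ← inner_conjTranspose_apply, hv]
  simp

theorem IsIsometric.norm_sq_eq (hT : IsIsometric T) (a v : EuclideanSpace ℂ κ) :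
    ‖v - T.toEuclideanLin (Tᴴ.toEuclideanLin v) + T.toEuclideanLin (Tᴴ.toEuclideanLin a)‖ ^ 2 =
      ‖v - T.toEuclideanLin (Tᴴ.toEuclideanLin v)‖ ^ 2 +
        ‖T.toEuclideanLin (Tᴴ.toEuclideanLin a)‖ ^ 2 := by
  rw [norm_add_sq_real, real_inner_apply_of_conjTranspose_eq_zero]
  · ring
  · rw [map_sub, hT.conjTranspose_apply_apply, sub_self]

theorem IsIsometric.norm_sq_decomp (hT : IsIsometric T) (v : EuclideanSpace ℂ κ) :
    ‖v‖ ^ 2 = ‖v - T.toEuclideanLin (Tᴴ.toEuclideanLin v)‖ ^ 2 +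
        ‖T.toEuclideanLin (Tᴴ.toEuclideanLin v)‖ ^ 2 := by
  rw [← hT.norm_sq_eq, sub_add_cancel]

theorem IsIsometric.norm_conjTranspose_apply_le (hT : IsIsometric T) (v : EuclideanSpace ℂ κ) :
    ‖Tᴴ.toEuclideanLin v‖ ≤ ‖v‖ := by
  have h := hT.norm_sq_decomp v
  rw [hT.norm_apply] at h
  exact (sq_le_sq₀ (norm_nonneg _) (norm_nonneg _)).1 (by nlinarith [sq_nonneg ‖v - T.toEuclideanLin (Tᴴ.toEuclideanLin v)‖])

end Isometric

/-! ### Tangential projection -/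

section Tangent

variable {κ : Type*}

/-- The tangential part of `u` at `y₀`: in each coordinate, the real orthogonal projection of
`u j` to the line spanned by `i y₀ j`. -/
noncomputable def tangentPart (y₀ : EuclideanSpace ℂ κ) :
    EuclideanSpace ℂ κ →ₗ[ℝ] EuclideanSpace ℂ κ where
  toFun u := WithLp.toLp 2 fun j => ((u j / y₀ j).im : ℂ) * (Complex.I * y₀ j)
  map_add' u v := by
    ext j
    simp [add_div, add_mul]
  map_smul' r u := by
    ext j
    simp [mul_div_assoc, mul_assoc]

theorem tangentPart_apply (y₀ u : EuclideanSpace ℂ κ) (j : κ) :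
    tangentPart y₀ u j = ((u j / y₀ j).im : ℂ) * (Complex.I * y₀ j) := rfl

theorem re_tangentPart_div (y₀ u : EuclideanSpace ℂ κ) (j : κ) :
    (tangentPart y₀ u j / y₀ j).re = 0 := by
  rw [tangentPart_apply]
  by_cases h : y₀ j = 0
  · simp [h]
  · rw [← mul_assoc, mul_div_assoc, div_self h]
    simp

theorem tangentPart_tangentPart (y₀ u : EuclideanSpace ℂ κ) :
    tangentPart y₀ (tangentPart y₀ u) = tangentPart y₀ u := by
  ext j
  rw [tangentPart_apply, tangentPart_apply]
  by_cases h : y₀ j = 0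
  · simp [h]
  · congr 2
    rw [← mul_assoc, mul_div_assoc, div_self h]
    simp

theorem norm_sq_tangentPart [Fintype κ] (y₀ u : EuclideanSpace ℂ κ) :
    ‖u‖ ^ 2 = ‖u - tangentPart y₀ u‖ ^ 2 + ‖tangentPart y₀ u‖ ^ 2 := by
  rw [EuclideanSpace.norm_sq_eq, EuclideanSpace.norm_sq_eq, EuclideanSpace.norm_sq_eq,
    ← Finset.sum_add_distrib]
  refine Finset.sum_congr rfl fun j _ => ?_
  rw [PiLp.sub_apply, tangentPart_apply]
  by_cases h : y₀ j = 0
  · simp [h]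
  · obtain ⟨z, hz⟩ : ∃ z, u j = z * y₀ j := ⟨u j / y₀ j, (div_mul_cancel₀ _ h).symm⟩
    rw [hz, mul_div_assoc, div_self h, mul_one, ← mul_assoc, ← sub_mul, norm_mul, norm_mul,
      norm_mul, mul_pow, mul_pow, mul_pow, ← add_mul]
    congr 1
    simp [← Complex.normSq_eq_norm_sq, Complex.normSq_apply]
    ring

end Tangent

/-! ### First-order expansion of the phase -/

section Phase

/-- The real shift ω alone does not change the phase, so the error carries a factor ‖z‖. This keeps
the later estimates uniform along the family of fixed points. -/
theorem norm_normalize_sub_le {ω : ℝ} {z : ℂ} (h : |ω| + ‖z‖ ≤ 1 / 2) :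
    ‖(1 + ω + z) / (‖(1 + ω + z)‖ : ℂ) - 1 - z.im * Complex.I‖ ≤ 6 * (|ω| + ‖z‖) * ‖z‖ := by
  set s := |ω| + ‖z‖ with hs
  set ζ : ℂ := 1 + ω + z with hζ
  have hzn := norm_nonneg z
  have hre : |z.re| ≤ ‖z‖ := Complex.abs_re_le_norm z
  have him : |z.im| ≤ ‖z‖ := Complex.abs_im_le_norm z
  have hx : |ζ.re - 1| ≤ s := by
    have : ζ.re - 1 = ω + z.re := by simp [hζ]; ring
    rw [this]
    exact (abs_add_le _ _).trans (by linarith)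
  have hζim : ζ.im = z.im := by simp [hζ]
  have hx' : 1 / 2 ≤ ζ.re := by have := (abs_le.1 hx).1; linarith
  have hN1 : |‖ζ‖ - 1| ≤ s := by
    have h1 : |‖ζ‖ - ‖(1 : ℂ)‖| ≤ ‖ζ - 1‖ := abs_norm_sub_norm_le _ _
    have h2 : ζ - 1 = (ω : ℂ) + z := by simp [hζ]; ring
    rw [h2, norm_one] at h1
    refine h1.trans ((norm_add_le _ _).trans ?_)
    simp [hs]
  have hNx : ζ.re ≤ ‖ζ‖ := Complex.re_le_norm ζ
  set N := ‖ζ‖ with hN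
  have hN0 : 1 / 2 ≤ N := hx'.trans hNx
  have hNpos : 0 < N := by linarith
  have hsq : N ^ 2 = ζ.re ^ 2 + z.im ^ 2 := by
    rw [hN, ← Complex.normSq_eq_norm_sq, Complex.normSq_apply, hζim]; ring
  have key : ζ / (N : ℂ) - 1 - z.im * Complex.I =
      (((ζ.re - N) / N : ℝ) : ℂ) + ((z.im * (1 - N) / N : ℝ) : ℂ) * Complex.I := by
    have hNC : (N : ℂ) ≠ 0 := by exact_mod_cast hNpos.ne'
    push_cast
    field_simp
    conv_lhs => rw [← Complex.re_add_im ζ]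
    rw [hζim]
    ring
  rw [key]
  refine (norm_add_le _ _).trans ?_
  rw [norm_mul, Complex.norm_I, mul_one, Complex.norm_real, Complex.norm_real, Real.norm_eq_abs,
    Real.norm_eq_abs, abs_div, abs_div, abs_of_pos hNpos, ← add_div, div_le_iff₀ hNpos, abs_mul,
    abs_sub_comm ζ.re N, abs_of_nonneg (sub_nonneg.2 hNx), abs_sub_comm 1 N]
  -- (N - Re ζ)(N + Re ζ) = (Im ζ)², and N + Re ζ ≥ 1.
  have h1 : N - ζ.re ≤ ‖z‖ ^ 2 := by
    have h2 : z.im ^ 2 ≤ ‖z‖ ^ 2 := by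
      rw [← sq_abs]; gcongr
    nlinarith
  have h3 : |z.im| * |N - 1| ≤ ‖z‖ * s := by gcongr
  have h4 : ‖z‖ ≤ s := by have := abs_nonneg ω; linarith
  have h5 : 0 ≤ s * ‖z‖ := mul_nonneg (hzn.trans h4) hzn
  nlinarith

theorem norm_mul_phase_sub_le {y₀ w u : ℂ} (h0 : y₀ ≠ 0) (hw : (w / y₀).im = 0)
    (h : ‖w‖ + ‖u‖ ≤ ‖y₀‖ / 2) :
    ‖(‖y₀‖ : ℂ) * phase (y₀ + w + u) - y₀ - ((u / y₀).im : ℂ) * (Complex.I * y₀)‖ ≤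
      6 / ‖y₀‖ * (‖w‖ + ‖u‖) * ‖u‖ := by
  have hn : 0 < ‖y₀‖ := norm_pos_iff.2 h0
  obtain ⟨ω, hω⟩ : ∃ ω : ℝ, w / y₀ = ω := ⟨(w / y₀).re, by
    apply Complex.ext <;> simp [hw]⟩
  have hw' : w = ω * y₀ := by rw [← hω, div_mul_cancel₀ _ h0]
  obtain ⟨z, hz⟩ : ∃ z, u = z * y₀ := ⟨u / y₀, (div_mul_cancel₀ _ h0).symm⟩
  subst hw' hz
  have hs : |ω| + ‖z‖ ≤ 1 / 2 := by
    simp only [norm_mul, Complex.norm_real, Real.norm_eq_abs] at h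
    rw [← add_mul, div_eq_inv_mul] at h
    have := le_of_mul_le_mul_right h hn
    linarith
  have hne : (1 + ω + z : ℂ) ≠ 0 := by
    intro h'
    have h1 : (1 : ℂ) = -(ω + z) := by linear_combination h'
    have h2 : ‖(1 : ℂ)‖ ≤ |ω| + ‖z‖ := by
      rw [h1, norm_neg]
      exact (norm_add_le _ _).trans (by simp)
    rw [norm_one] at h2
    linarith
  have e : y₀ + ω * y₀ + z * y₀ = (1 + ω + z) * y₀ := by ring
  have e2 : (‖y₀‖ : ℂ) * phase (y₀ + ω * y₀ + z * y₀) - y₀ -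
      ((z * y₀ / y₀).im : ℂ) * (Complex.I * y₀) =
      y₀ * ((1 + ω + z) / (‖(1 + ω + z : ℂ)‖ : ℂ) - 1 - z.im * Complex.I) := by
    rw [e, phase, if_neg (mul_ne_zero hne h0), mul_div_assoc z, div_self h0, norm_mul]
    have h1 : (‖y₀‖ : ℂ) ≠ 0 := by exact_mod_cast hn.ne'
    have h2 : (‖(1 + ω + z : ℂ)‖ : ℂ) ≠ 0 := by exact_mod_cast (norm_pos_iff.2 hne).ne'
    push_cast
    field_simp
  rw [e2, norm_mul]
  simp only [norm_mul, Complex.norm_real, Real.norm_eq_abs]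
  have := mul_le_mul_of_nonneg_left (norm_normalize_sub_le hs) hn.le
  refine this.trans (le_of_eq ?_)
  field_simp

end Phase

/-- Compactness of the unit sphere of `N` makes the strict inequality uniform. -/
theorem exists_norm_le_mul_of_norm_lt {E : Type*} [NormedAddCommGroup E] [NormedSpace ℝ E]
    [FiniteDimensional ℝ E] (N : Submodule ℝ E) (J : E →ₗ[ℝ] E)
    (hJ : ∀ u ∈ N, u ≠ 0 → ‖J u‖ < ‖u‖) :
    ∃ lam : ℝ, 0 ≤ lam ∧ lam < 1 ∧ ∀ u ∈ N, ‖J u‖ ≤ lam * ‖u‖ := by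
  have : ProperSpace E := FiniteDimensional.proper_real E
  have hcpt : IsCompact ((N : Set E) ∩ Metric.sphere 0 1) :=
    (isCompact_sphere 0 1).inter_left N.closed_of_finiteDimensional
  have hcont : ContinuousOn (fun u => ‖J u‖) ((N : Set E) ∩ Metric.sphere 0 1) :=
    (continuous_norm.comp J.continuous_of_finiteDimensional).continuousOn
  rcases ((N : Set E) ∩ Metric.sphere 0 1).eq_empty_or_nonempty with hempty | hne
  · refine ⟨0, le_rfl, one_pos, fun u hu => ?_⟩
    by_cases h0 : u = 0
    · simp [h0]
    · exfalso
      have : (‖u‖⁻¹ • u) ∈ (N : Set E) ∩ Metric.sphere 0 1 := by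
        refine ⟨N.smul_mem _ hu, ?_⟩
        rw [mem_sphere_zero_iff_norm, norm_smul, norm_inv, norm_norm,
          inv_mul_cancel₀ (norm_ne_zero_iff.2 h0)]
      rw [hempty] at this
      exact this
  · obtain ⟨v, ⟨hvN, hv1⟩, hmax⟩ := hcpt.exists_isMaxOn hne hcont
    rw [mem_sphere_zero_iff_norm] at hv1
    refine ⟨‖J v‖, norm_nonneg _, ?_, fun u hu => ?_⟩
    · rw [← hv1]
      exact hJ v hvN (by rintro rfl; simp at hv1)
    · by_cases h0 : u = 0
      · simp [h0]
      · have hn := norm_pos_iff.2 h0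
        have hmem : (‖u‖⁻¹ • u) ∈ (N : Set E) ∩ Metric.sphere 0 1 := by
          refine ⟨N.smul_mem _ hu, ?_⟩
          rw [mem_sphere_zero_iff_norm, norm_smul, norm_inv, norm_norm,
            inv_mul_cancel₀ hn.ne']
        have h := hmax hmem
        simp only [Set.mem_ofPred_eq, map_smul, norm_smul, norm_inv, norm_norm] at h
        rwa [inv_mul_le_iff₀ hn, mul_comm] at h

/-! ### Expansion of the data-fitting step -/

section Fit

variable {κ : Type*} [Fintype κ]

theorem exists_pos_le_norm_apply (y₀ : EuclideanSpace ℂ κ) :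
    ∃ β : ℝ, 0 < β ∧ ∀ j, y₀ j ≠ 0 → β ≤ ‖y₀ j‖ := by
  classical
  rcases (Finset.univ.filter fun j => y₀ j ≠ 0).eq_empty_or_nonempty with h | h
  · refine ⟨1, one_pos, fun j hj => ?_⟩
    have : j ∈ Finset.univ.filter fun j => y₀ j ≠ 0 := by simp [hj]
    simp [h] at this
  · obtain ⟨j₀, hj₀, hmin⟩ := Finset.exists_min_image _ (fun j => ‖y₀ j‖) h
    refine ⟨‖y₀ j₀‖, norm_pos_iff.2 (by simpa using hj₀), fun j hj => hmin j (by simp [hj])⟩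

/-- Coordinates with `y₀ j = 0` carry zero data and contribute no error; the others are bounded away
from zero. -/
theorem exists_norm_fitData_sub_le (y₀ : EuclideanSpace ℂ κ) :
    ∃ C ε : ℝ, 0 ≤ C ∧ 0 < ε ∧
      (∀ y : EuclideanSpace ℂ κ, ‖y - y₀‖ ≤ ε → ∀ j, y₀ j ≠ 0 → y j ≠ 0) ∧
      ∀ w u : EuclideanSpace ℂ κ, tangentPart y₀ w = 0 → ‖w‖ + ‖u‖ ≤ ε →
        ‖fitData (fun j => ‖y₀ j‖) (y₀ + w + u) - y₀ - tangentPart y₀ u‖ ≤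
          C * (‖w‖ + ‖u‖) * ‖u‖ := by
  obtain ⟨β, hβ, hle⟩ := exists_pos_le_norm_apply y₀
  refine ⟨6 / β, β / 2, by positivity, by positivity, fun y hy j hj h0 => ?_,
    fun w u hw h => ?_⟩
  · have h1 := (PiLp.norm_apply_le (y - y₀) j).trans hy
    rw [PiLp.sub_apply, h0, zero_sub, norm_neg] at h1
    linarith [hle j hj]
  · set e := fitData (fun j => ‖y₀ j‖) (y₀ + w + u) - y₀ - tangentPart y₀ u with he
    set c := 6 / β * (‖w‖ + ‖u‖) with hc
    have hc0 : 0 ≤ c := by positivity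
    have hcoord : ∀ j, ‖e j‖ ≤ c * ‖u j‖ := by
      intro j
      have hej : e j = (‖y₀ j‖ : ℂ) * phase (y₀ j + w j + u j) - y₀ j -
        ((u j / y₀ j).im : ℂ) * (Complex.I * y₀ j) := rfl
      by_cases h0 : y₀ j = 0
      · rw [hej, h0]
        simp only [norm_zero, Complex.ofReal_zero, zero_mul, mul_zero, sub_zero]
        positivity
      · have hb := hle j h0
        have hwj := PiLp.norm_apply_le w j
        have huj := PiLp.norm_apply_le u j
        have hwt : (w j / y₀ j).im = 0 := by
          have h1 : tangentPart y₀ w j = 0 := by rw [hw]; rfl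
          rw [tangentPart_apply] at h1
          simpa [h0] using h1
        rw [hej]
        refine (norm_mul_phase_sub_le h0 hwt (by linarith)).trans ?_
        rw [hc]
        gcongr
    have hsq : ‖e‖ ^ 2 ≤ (c * ‖u‖) ^ 2 := by
      rw [mul_pow, EuclideanSpace.norm_sq_eq, EuclideanSpace.norm_sq_eq, Finset.mul_sum]
      refine Finset.sum_le_sum fun j _ => ?_
      rw [← mul_pow]
      exact pow_le_pow_left₀ (norm_nonneg _) (hcoord j) 2
    exact (sq_le_sq₀ (norm_nonneg _) (by positivity)).1 hsq

/-- The nonvanishing hypothesis is needed because the convention `phase 0 = 1` does not commute with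
rotations. -/
theorem fitData_smul {y₀ y : EuclideanSpace ℂ κ} (hy : ∀ j, y₀ j ≠ 0 → y j ≠ 0) {α : ℂ}
    (hα : ‖α‖ = 1) :
    fitData (fun j => ‖y₀ j‖) (α • y) = α • fitData (fun j => ‖y₀ j‖) y := by
  ext j
  change (‖y₀ j‖ : ℂ) * phase (α * y j) = α * ((‖y₀ j‖ : ℂ) * phase (y j))
  by_cases h0 : y₀ j = 0
  · simp [h0]
  · have hα0 : α ≠ 0 := by rintro rfl; simp at hα
    rw [phase, phase, if_neg (mul_ne_zero hα0 (hy j h0)), if_neg (hy j h0), norm_mul, hα]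
    simp only [one_mul]
    ring

end Fit

/-! ### Linearized map and one-step estimate -/

section Linearization

variable {κ ι : Type*} [Fintype κ] [DecidableEq κ] [Fintype ι] [DecidableEq ι]

/-- The orthogonal projection to the range of an isometric matrix. -/
noncomputable def rangeProj (T : Matrix κ ι ℂ) : EuclideanSpace ℂ κ →ₗ[ℂ] EuclideanSpace ℂ κ :=
  T.toEuclideanLin ∘ₗ Tᴴ.toEuclideanLin

theorem rangeProj_apply (T : Matrix κ ι ℂ) (v : EuclideanSpace ℂ κ) :
    rangeProj T v = T.toEuclideanLin (Tᴴ.toEuclideanLin v) := rfl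

/-- The real-linear part at `y₀` of the Fourier-domain Douglas–Rachford map. -/
noncomputable def fdrDeriv (T : Matrix κ ι ℂ) (y₀ : EuclideanSpace ℂ κ) :
    EuclideanSpace ℂ κ →ₗ[ℝ] EuclideanSpace ℂ κ :=
  (LinearMap.id - tangentPart y₀) - ((rangeProj T).restrictScalars ℝ) ∘ₗ
    (LinearMap.id - tangentPart y₀) + ((rangeProj T).restrictScalars ℝ) ∘ₗ tangentPart y₀

theorem fdrDeriv_apply (T : Matrix κ ι ℂ) (y₀ u : EuclideanSpace ℂ κ) :
    fdrDeriv T y₀ u = (u - tangentPart y₀ u) - rangeProj T (u - tangentPart y₀ u) +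
      rangeProj T (tangentPart y₀ u) := rfl

/-- The displacements of the fixed point `y₀` along which the map stays fixed, apart from the
rotations by a global phase. -/
noncomputable def fixedDir (T : Matrix κ ι ℂ) (y₀ : EuclideanSpace ℂ κ) :
    Submodule ℝ (EuclideanSpace ℂ κ) :=
  LinearMap.ker (Tᴴ.toEuclideanLin.restrictScalars ℝ) ⊓ LinearMap.ker (tangentPart y₀)

theorem mem_fixedDir {T : Matrix κ ι ℂ} {y₀ w : EuclideanSpace ℂ κ} :
    w ∈ fixedDir T y₀ ↔ Tᴴ.toEuclideanLin w = 0 ∧ tangentPart y₀ w = 0 := Iff.rfl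

theorem apply_mem_fixedDir_orthogonal (T : Matrix κ ι ℂ) (y₀ : EuclideanSpace ℂ κ)
    (x : EuclideanSpace ℂ ι) : T.toEuclideanLin x ∈ (fixedDir T y₀)ᗮ := by
  rw [Submodule.mem_orthogonal]
  exact fun w hw => real_inner_apply_of_conjTranspose_eq_zero (mem_fixedDir.1 hw).1 x

variable {T : Matrix κ ι ℂ}

theorem IsIsometric.norm_sq_fdrDeriv (hT : IsIsometric T) (y₀ u : EuclideanSpace ℂ κ) :
    ‖u‖ ^ 2 = ‖fdrDeriv T y₀ u‖ ^ 2 + ‖rangeProj T (u - tangentPart y₀ u)‖ ^ 2 +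
      ‖tangentPart y₀ u - rangeProj T (tangentPart y₀ u)‖ ^ 2 := by
  rw [fdrDeriv_apply, norm_sq_tangentPart y₀ u]
  simp only [rangeProj_apply]
  rw [hT.norm_sq_eq, hT.norm_sq_decomp (u - tangentPart y₀ u),
    hT.norm_sq_decomp (tangentPart y₀ u)]
  ring

theorem IsIsometric.norm_fdrDeriv_le (hT : IsIsometric T) (y₀ u : EuclideanSpace ℂ κ) :
    ‖fdrDeriv T y₀ u‖ ≤ ‖u‖ := by
  have := hT.norm_sq_fdrDeriv y₀ u
  refine (sq_le_sq₀ (norm_nonneg _) (norm_nonneg _)).1 ?_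
  nlinarith [sq_nonneg ‖rangeProj T (u - tangentPart y₀ u)‖,
    sq_nonneg ‖tangentPart y₀ u - rangeProj T (tangentPart y₀ u)‖]

/-- The only objects whose transforms have the phases of `± i T x₀` are the real multiples of
`i x₀`. -/
def HasRigidPhase (T : Matrix κ ι ℂ) (x₀ : EuclideanSpace ℂ ι) : Prop :=
  ∀ u : EuclideanSpace ℂ ι, (∀ j, (T.toEuclideanLin u j / T.toEuclideanLin x₀ j).re = 0) →
    ∃ t : ℝ, u = t • Complex.I • x₀

/-- In the equality case rigidity makes τu a multiple of iy₀ and puts u - τu in `fixedDir`; u is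
orthogonal to both, hence to itself. -/
theorem IsIsometric.norm_fdrDeriv_lt (hT : IsIsometric T) {x₀ : EuclideanSpace ℂ ι}
    (hx₀ : HasRigidPhase T x₀) {u : EuclideanSpace ℂ κ}
    (hu : u ∈ (fixedDir T (T.toEuclideanLin x₀))ᗮ)
    (hu' : inner ℝ u (Complex.I • T.toEuclideanLin x₀) = 0) (h0 : u ≠ 0) :
    ‖fdrDeriv T (T.toEuclideanLin x₀) u‖ < ‖u‖ := by
  set y₀ := T.toEuclideanLin x₀ with hy₀
  refine lt_of_le_of_ne (hT.norm_fdrDeriv_le y₀ u) fun heq => h0 ?_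
  have h := hT.norm_sq_fdrDeriv y₀ u
  rw [heq] at h
  have h1 : ‖rangeProj T (u - tangentPart y₀ u)‖ ^ 2 = 0 := by
    nlinarith [sq_nonneg ‖rangeProj T (u - tangentPart y₀ u)‖,
      sq_nonneg ‖tangentPart y₀ u - rangeProj T (tangentPart y₀ u)‖]
  have h2 : ‖tangentPart y₀ u - rangeProj T (tangentPart y₀ u)‖ ^ 2 = 0 := by
    nlinarith [sq_nonneg ‖rangeProj T (u - tangentPart y₀ u)‖,
      sq_nonneg ‖tangentPart y₀ u - rangeProj T (tangentPart y₀ u)‖]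
  have h1 : rangeProj T (u - tangentPart y₀ u) = 0 := by simpa using h1
  have h2 : tangentPart y₀ u - rangeProj T (tangentPart y₀ u) = 0 := by simpa using h2
  have h2 : T.toEuclideanLin (Tᴴ.toEuclideanLin (tangentPart y₀ u)) = tangentPart y₀ u :=
    (sub_eq_zero.1 h2).symm
  obtain ⟨t, ht⟩ := hx₀ (Tᴴ.toEuclideanLin (tangentPart y₀ u)) fun j => by
    rw [h2]; exact re_tangentPart_div y₀ u j
  rw [ht] at h2
  have h3 : tangentPart y₀ u = t • Complex.I • y₀ := by
    rw [← h2, hy₀, LinearMap.map_smul_of_tower, map_smul]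
  have h4 : u - tangentPart y₀ u ∈ fixedDir T y₀ := by
    rw [mem_fixedDir]
    constructor
    · rw [← norm_eq_zero, ← hT.norm_apply]
      rw [rangeProj_apply] at h1
      rw [h1, norm_zero]
    · rw [map_sub, tangentPart_tangentPart, sub_self]
  have h5 : inner ℝ u (u - tangentPart y₀ u) = 0 := by
    rw [real_inner_comm]
    exact (Submodule.mem_orthogonal _ _).1 hu _ h4
  rw [h3, inner_sub_right, real_inner_smul_right, hu', mul_zero, sub_zero] at h5
  exact inner_self_eq_zero.1 h5

/-- The number `r` allows u to be only nearly orthogonal to iy₀: its component along iy₀ has norm at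
most r‖u‖/‖x₀‖, and J does not enlarge it. -/
theorem IsIsometric.exists_norm_fdrDeriv_le (hT : IsIsometric T) {x₀ : EuclideanSpace ℂ ι}
    (hx₀ : HasRigidPhase T x₀) (hne : x₀ ≠ 0) :
    ∃ lam : ℝ, 0 ≤ lam ∧ lam < 1 ∧ ∀ u ∈ (fixedDir T (T.toEuclideanLin x₀))ᗮ, ∀ r : ℝ,
      |inner ℝ u (Complex.I • T.toEuclideanLin x₀)| ≤ r * ‖u‖ →
      ‖fdrDeriv T (T.toEuclideanLin x₀) u‖ ≤ (lam + r / ‖x₀‖) * ‖u‖ := by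
  set y₀ := T.toEuclideanLin x₀ with hy₀
  have hn : ‖Complex.I • y₀‖ = ‖x₀‖ := by
    rw [norm_smul, Complex.norm_I, one_mul, hy₀, hT.norm_apply]
  have hpos : 0 < ‖x₀‖ := norm_pos_iff.2 hne
  have heorth : Complex.I • y₀ ∈ (fixedDir T y₀)ᗮ := by
    rw [hy₀, ← map_smul]
    exact apply_mem_fixedDir_orthogonal T _ _
  obtain ⟨lam, h0, h1, hlam⟩ := exists_norm_le_mul_of_norm_lt
    ((fixedDir T y₀)ᗮ ⊓ (Submodule.span ℝ {Complex.I • y₀})ᗮ) (fdrDeriv T y₀)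
    (fun u hu hu0 => hT.norm_fdrDeriv_lt hx₀ hu.1
      (by rw [real_inner_comm]; exact (Submodule.mem_orthogonal_singleton_iff_inner_right).1 hu.2) hu0)
  refine ⟨lam, h0, h1, fun u hu r hr => ?_⟩
  set e := Complex.I • y₀ with he
  set s := inner ℝ u e / ‖x₀‖ ^ 2 with hs
  have hee : inner ℝ e e = ‖x₀‖ ^ 2 := by rw [real_inner_self_eq_norm_sq, hn]
  have hue : inner ℝ (u - s • e) e = 0 := by
    rw [inner_sub_left, real_inner_smul_left, hee, hs]
    field_simp
    ring
  have hmem : u - s • e ∈ (fixedDir T y₀)ᗮ ⊓ (Submodule.span ℝ {e})ᗮ := by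
    refine ⟨Submodule.sub_mem _ hu (Submodule.smul_mem _ _ heorth), ?_⟩
    rw [SetLike.mem_coe, Submodule.mem_orthogonal_singleton_iff_inner_right, real_inner_comm, hue]
  have hle : ‖u - s • e‖ ≤ ‖u‖ := by
    have h2 : ‖u‖ ^ 2 = ‖u - s • e‖ ^ 2 + ‖s • e‖ ^ 2 := by
      conv_lhs => rw [← sub_add_cancel u (s • e)]
      rw [norm_add_sq_real, real_inner_smul_right, hue]
      ring
    refine (sq_le_sq₀ (norm_nonneg _) (norm_nonneg _)).1 ?_
    nlinarith [sq_nonneg ‖s • e‖]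
  have hse : ‖s • e‖ ≤ r / ‖x₀‖ * ‖u‖ := by
    rw [norm_smul, hn, hs, Real.norm_eq_abs, abs_div, abs_of_nonneg (sq_nonneg ‖x₀‖)]
    calc |inner ℝ u e| / ‖x₀‖ ^ 2 * ‖x₀‖ = |inner ℝ u e| / ‖x₀‖ := by field_simp
      _ ≤ r * ‖u‖ / ‖x₀‖ := by gcongr
      _ = _ := by ring
  calc ‖fdrDeriv T y₀ u‖ = ‖fdrDeriv T y₀ (u - s • e) + fdrDeriv T y₀ (s • e)‖ := by
        rw [← map_add, sub_add_cancel]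
    _ ≤ ‖fdrDeriv T y₀ (u - s • e)‖ + ‖fdrDeriv T y₀ (s • e)‖ := norm_add_le _ _
    _ ≤ lam * ‖u - s • e‖ + ‖s • e‖ := add_le_add (hlam _ hmem) (hT.norm_fdrDeriv_le y₀ _)
    _ ≤ lam * ‖u‖ + r / ‖x₀‖ * ‖u‖ := by gcongr
    _ = _ := by ring

/-- This is the reflection 2P - 1, through which the remainder enters the step without
amplification. -/
theorem IsIsometric.norm_sub_rangeProj_add (hT : IsIsometric T) (e : EuclideanSpace ℂ κ) :
    ‖-(e - rangeProj T e) + rangeProj T e‖ = ‖e‖ := by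
  have h1 := hT.norm_sq_eq (-e) e
  have h2 := hT.norm_sq_decomp e
  simp only [map_neg, ← rangeProj_apply] at h1 h2
  rw [norm_neg, ← h2] at h1
  have h3 := (sq_eq_sq₀ (norm_nonneg _) (norm_nonneg _)).1 h1
  rw [← h3, ← norm_neg]
  congr 1
  abel

/-- Exact form of the Fourier-domain Douglas–Rachford step near the fixed point `T x₀ + w`. -/
theorem IsIsometric.fdrMap_sub_eq (hT : IsIsometric T) (x₀ : EuclideanSpace ℂ ι) (b : κ → ℝ)
    {w u : EuclideanSpace ℂ κ} (hw : Tᴴ.toEuclideanLin w = 0) {e : EuclideanSpace ℂ κ}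
    (he : e = fitData b (T.toEuclideanLin x₀ + w + u) - T.toEuclideanLin x₀ -
      tangentPart (T.toEuclideanLin x₀) u) :
    fdrMap T b (T.toEuclideanLin x₀ + w + u) - (T.toEuclideanLin x₀ + w) =
      fdrDeriv T (T.toEuclideanLin x₀) u + (-(e - rangeProj T e) + rangeProj T e) := by
  set y₀ := T.toEuclideanLin x₀ with hy₀
  have hfit : fitData b (y₀ + w + u) = y₀ + tangentPart y₀ u + e := by rw [he]; abel
  have hPy : rangeProj T y₀ = y₀ := by
    rw [rangeProj_apply, hy₀, hT.conjTranspose_apply_apply]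
  have hPw : rangeProj T w = 0 := by rw [rangeProj_apply, hw, map_zero]
  rw [fdrMap, ← rangeProj_apply, hfit, fdrDeriv_apply]
  simp only [map_sub, map_add, map_smul, hPy, hPw]
  module

theorem IsIsometric.exists_norm_fdrMap_sub_le (hT : IsIsometric T) {x₀ : EuclideanSpace ℂ ι}
    (hx₀ : HasRigidPhase T x₀) (hne : x₀ ≠ 0) :
    ∃ γ ε : ℝ, 0 ≤ γ ∧ γ < 1 ∧ 0 < ε ∧
      ∀ w ∈ fixedDir T (T.toEuclideanLin x₀), ∀ u ∈ (fixedDir T (T.toEuclideanLin x₀))ᗮ,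
      |inner ℝ u (Complex.I • T.toEuclideanLin x₀)| ≤ ‖w‖ * ‖u‖ → ‖w‖ ≤ ε → ‖u‖ ≤ ε →
      ‖fdrMap T (magnitudes T x₀) (T.toEuclideanLin x₀ + w + u) - (T.toEuclideanLin x₀ + w)‖ ≤
        γ * ‖u‖ := by
  obtain ⟨lam, h0, h1, hlam⟩ := hT.exists_norm_fdrDeriv_le hx₀ hne
  obtain ⟨C, ε₀, hC, hε₀, -, hfit⟩ := exists_norm_fitData_sub_le (T.toEuclideanLin x₀)
  have hpos : 0 < ‖x₀‖ := norm_pos_iff.2 hne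
  set K := 1 / ‖x₀‖ + 2 * C with hK
  have hK0 : 0 < K := by positivity
  -- The second bound lets ‖w‖/‖x₀‖ and C(‖w‖+‖u‖) together consume at most half of the gap 1 - lam.
  set ε := min (ε₀ / 2) ((1 - lam) / 2 / K) with hε
  have hε1 : ε ≤ ε₀ / 2 := min_le_left _ _
  have hε2 : ε * K ≤ (1 - lam) / 2 := (le_div_iff₀ hK0).1 (min_le_right _ _)
  have hεpos : 0 < ε := lt_min (by positivity) (div_pos (by linarith) hK0)
  refine ⟨(1 + lam) / 2, ε, by linarith, by linarith, hεpos,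
    fun w hw u hu hin hwε huε => ?_⟩
  have hfd : (magnitudes T x₀) = fun j => ‖T.toEuclideanLin x₀ j‖ := rfl
  rw [hfd, hT.fdrMap_sub_eq x₀ _ (mem_fixedDir.1 hw).1 rfl]
  refine (norm_add_le _ _).trans ?_
  rw [hT.norm_sub_rangeProj_add]
  have e1 := hlam u hu ‖w‖ hin
  have e2 := hfit w u (mem_fixedDir.1 hw).2 (by linarith)
  refine (add_le_add e1 e2).trans ?_
  rw [← add_mul]
  refine mul_le_mul_of_nonneg_right ?_ (norm_nonneg u)
  have e3 : ‖w‖ / ‖x₀‖ ≤ ε * (1 / ‖x₀‖) := by rw [mul_one_div]; gcongr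
  have e4 : C * (‖w‖ + ‖u‖) ≤ C * (ε + ε) := by gcongr
  have e5 : ε * K = ε * (1 / ‖x₀‖) + C * (ε + ε) := by rw [hK]; ring
  linarith

end Linearization

/-! ### Optimal phases and local convergence -/

theorem exists_unit_complex_minimizer {f : ℂ → ℝ} (hf : Continuous f) :
    ∃ α : ℂ, ‖α‖ = 1 ∧ ∀ β : ℂ, ‖β‖ = 1 → f α ≤ f β := by
  obtain ⟨α, hα, hmin⟩ := (isCompact_sphere (0 : ℂ) 1).exists_isMinOn
    ⟨1, by simp⟩ hf.continuousOn
  exact ⟨α, by simpa using hα, fun β hβ => hmin (by simpa using hβ)⟩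

theorem exists_isOptimalPhase {ι : Type*} [Fintype ι] (x x₀ : EuclideanSpace ℂ ι) :
    ∃ α : ℂ, IsOptimalPhase x x₀ α :=
  exists_unit_complex_minimizer (f := fun α : ℂ => ‖α • x - x₀‖) (by fun_prop)

section Dynamics

variable {κ ι : Type*} [Fintype κ]

/-- First-order condition at t = 0 along the circle β = exp(it). -/
theorem inner_I_smul_eq_zero_of_minimizer
    (Q : EuclideanSpace ℂ κ →L[ℝ] EuclideanSpace ℂ κ) {v y₀ : EuclideanSpace ℂ κ}
    (hmin : ∀ β : ℂ, ‖β‖ = 1 → ‖Q (v - y₀)‖ ≤ ‖Q (β • v - y₀)‖) :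
    inner ℝ (Q (v - y₀)) (Q (Complex.I • v)) = 0 := by
  have hexp : HasDerivAt (fun t : ℝ => Complex.exp (t * Complex.I)) Complex.I 0 := by
    have h1 : HasDerivAt (fun t : ℝ => (t : ℂ) * Complex.I) (1 * Complex.I) 0 :=
      (Complex.ofRealCLM.hasDerivAt (x := 0)).mul_const Complex.I
    simpa using h1.cexp
  have hline : HasDerivAt (fun t : ℝ => Q (Complex.exp (t * Complex.I) • v - y₀))
      (Q (Complex.I • v)) 0 :=
    Q.hasFDerivAt.comp_hasDerivAt 0 ((hexp.smul_const v).sub_const y₀)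
  have hsq := hline.norm_sq
  have hloc : IsLocalMin (fun t : ℝ => ‖Q (Complex.exp (t * Complex.I) • v - y₀)‖ ^ 2) 0 := by
    refine Filter.Eventually.of_forall fun t => ?_
    simp only [Complex.ofReal_zero, zero_mul, Complex.exp_zero, one_smul]
    exact pow_le_pow_left₀ (norm_nonneg _) (hmin _ (Complex.norm_exp_ofReal_mul_I t)) 2
  have := hloc.hasDerivAt_eq_zero hsq
  simpa using this

variable [DecidableEq κ] [Fintype ι] [DecidableEq ι]

/-- The orthogonal projection that forgets the displacements along `fixedDir`. -/
noncomputable def driftFree (T : Matrix κ ι ℂ) (y₀ : EuclideanSpace ℂ κ) :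
    EuclideanSpace ℂ κ →L[ℝ] EuclideanSpace ℂ κ :=
  (fixedDir T y₀)ᗮ.starProjection

theorem driftFree_mem (T : Matrix κ ι ℂ) (y₀ v : EuclideanSpace ℂ κ) :
    driftFree T y₀ v ∈ (fixedDir T y₀)ᗮ :=
  Submodule.starProjection_apply_mem _ v

theorem sub_driftFree_mem (T : Matrix κ ι ℂ) (y₀ v : EuclideanSpace ℂ κ) :
    v - driftFree T y₀ v ∈ fixedDir T y₀ := by
  have := Submodule.sub_starProjection_mem_orthogonal (K := (fixedDir T y₀)ᗮ) v
  rwa [Submodule.orthogonal_orthogonal] at this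

theorem norm_driftFree_le (T : Matrix κ ι ℂ) (y₀ v : EuclideanSpace ℂ κ) :
    ‖driftFree T y₀ v‖ ≤ ‖v‖ :=
  Submodule.norm_starProjection_apply_le _ v

theorem driftFree_eq_self {T : Matrix κ ι ℂ} {y₀ v : EuclideanSpace ℂ κ}
    (hv : v ∈ (fixedDir T y₀)ᗮ) : driftFree T y₀ v = v :=
  Submodule.starProjection_eq_self_iff.2 hv

theorem driftFree_eq_zero {T : Matrix κ ι ℂ} {y₀ w : EuclideanSpace ℂ κ}
    (hw : w ∈ fixedDir T y₀) : driftFree T y₀ w = 0 := by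
  rw [driftFree, Submodule.starProjection_apply_eq_zero_iff, Submodule.orthogonal_orthogonal]
  exact hw

variable {T : Matrix κ ι ℂ}

theorem fdrMap_smul {b : κ → ℝ} {α : ℂ} {y : EuclideanSpace ℂ κ}
    (h : fitData b (α • y) = α • fitData b y) : fdrMap T b (α • y) = α • fdrMap T b y := by
  rw [fdrMap, fdrMap, h]
  simp only [map_sub, map_smul]
  module

/-- `α` is the phase that brings `y` closest to the fixed points `T x₀ + w`,
`w ∈ fixedDir T (T x₀)`. -/
def IsOptimalDataPhase (T : Matrix κ ι ℂ) (y₀ y : EuclideanSpace ℂ κ) (α : ℂ) : Prop :=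
  ‖α‖ = 1 ∧ ∀ β : ℂ, ‖β‖ = 1 →
    ‖driftFree T y₀ (α • y - y₀)‖ ≤ ‖driftFree T y₀ (β • y - y₀)‖

theorem exists_isOptimalDataPhase (T : Matrix κ ι ℂ) (y₀ y : EuclideanSpace ℂ κ) :
    ∃ α : ℂ, IsOptimalDataPhase T y₀ y α :=
  exists_unit_complex_minimizer (f := fun α : ℂ => ‖driftFree T y₀ (α • y - y₀)‖) (by fun_prop)

/-- The vector (α-1)y₀ is fixed by `driftFree`, so minimality bounds it by 2‖y - y₀‖; the rotated
error α(y - y₀) adds one more. -/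
theorem IsOptimalDataPhase.norm_smul_sub_le {x₀ : EuclideanSpace ℂ ι}
    {y : EuclideanSpace ℂ κ} {α : ℂ} (hα : IsOptimalDataPhase T (T.toEuclideanLin x₀) y α) :
    ‖α • y - T.toEuclideanLin x₀‖ ≤ 3 * ‖y - T.toEuclideanLin x₀‖ := by
  set y₀ := T.toEuclideanLin x₀ with hy₀
  have hmem : (α - 1) • y₀ ∈ (fixedDir T y₀)ᗮ := by
    rw [hy₀, ← map_smul T.toEuclideanLin]
    exact apply_mem_fixedDir_orthogonal T _ _
  have hdec : α • y - y₀ = (α - 1) • y₀ + α • (y - y₀) := by module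
  have h1 : ‖driftFree T y₀ (α • y - y₀)‖ ≤ ‖y - y₀‖ := by
    have := hα.2 1 norm_one
    rw [one_smul] at this
    exact this.trans (norm_driftFree_le T y₀ _)
  have hαe : ‖α • (y - y₀)‖ = ‖y - y₀‖ := by rw [norm_smul, hα.1, one_mul]
  have h2 : ‖driftFree T y₀ (α • (y - y₀))‖ ≤ ‖y - y₀‖ :=
    (norm_driftFree_le T y₀ _).trans hαe.le
  have h3 : (α - 1) • y₀ =
      driftFree T y₀ (α • y - y₀) - driftFree T y₀ (α • (y - y₀)) := by
    rw [← map_sub, hdec, add_sub_cancel_right, driftFree_eq_self hmem]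
  have h4 : ‖(α - 1) • y₀‖ ≤ 2 * ‖y - y₀‖ := by
    rw [h3]
    refine (norm_sub_le _ _).trans ?_
    linarith
  rw [hdec]
  refine (norm_add_le _ _).trans ?_
  rw [hαe]
  linarith

theorem IsIsometric.exists_fdrMap_contraction (hT : IsIsometric T) {x₀ : EuclideanSpace ℂ ι}
    (hx₀ : HasRigidPhase T x₀) (hne : x₀ ≠ 0) :
    ∃ γ ε : ℝ, 0 ≤ γ ∧ γ < 1 ∧ 0 < ε ∧
      ∀ (y : EuclideanSpace ℂ κ) (α : ℂ), ‖y - T.toEuclideanLin x₀‖ ≤ ε →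
      IsOptimalDataPhase T (T.toEuclideanLin x₀) y α →
      ‖driftFree T (T.toEuclideanLin x₀)
          (α • fdrMap T (magnitudes T x₀) y - T.toEuclideanLin x₀)‖ ≤
        γ * ‖driftFree T (T.toEuclideanLin x₀) (α • y - T.toEuclideanLin x₀)‖ ∧
      ‖fdrMap T (magnitudes T x₀) y - y‖ ≤
        2 * ‖driftFree T (T.toEuclideanLin x₀) (α • y - T.toEuclideanLin x₀)‖ := by
  obtain ⟨γ, ε, h0, h1, hε, hK⟩ := hT.exists_norm_fdrMap_sub_le hx₀ hne
  obtain ⟨C, ε₀, hC, hε₀, hnz, -⟩ := exists_norm_fitData_sub_le (T.toEuclideanLin x₀)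
  set y₀ := T.toEuclideanLin x₀ with hy₀
  -- The radius ε/6 gives ‖αy - y₀‖ ≤ ε/2, hence ‖u‖ ≤ ε/2 and ‖w‖ ≤ ε; the radius ε₀ keeps
  -- coordinates nonzero for phase equivariance.
  refine ⟨γ, min ε₀ (ε / 6), h0, h1, lt_min hε₀ (by positivity), fun y α hy hα => ?_⟩
  set v := α • y with hv
  set u := driftFree T y₀ (v - y₀) with hu
  set w := v - y₀ - u with hw
  have hvd : ‖v - y₀‖ ≤ ε / 2 := by
    have := hα.norm_smul_sub_le
    have := hy.trans (min_le_right _ _)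
    linarith
  have hun : ‖u‖ ≤ ‖v - y₀‖ := norm_driftFree_le T y₀ _
  have hwn : ‖w‖ ≤ ‖v - y₀‖ + ‖u‖ := norm_sub_le _ _
  have humem : u ∈ (fixedDir T y₀)ᗮ := driftFree_mem T y₀ _
  have hwmem : w ∈ fixedDir T y₀ := sub_driftFree_mem T y₀ _
  have hveq : v = y₀ + w + u := by rw [hw]; abel
  have hmin : ∀ β : ℂ, ‖β‖ = 1 → ‖driftFree T y₀ (v - y₀)‖ ≤ ‖driftFree T y₀ (β • v - y₀)‖ := by
    intro β hβ
    rw [hv, smul_smul]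
    exact hα.2 _ (by rw [norm_mul, hβ, hα.1, one_mul])
  have hort := inner_I_smul_eq_zero_of_minimizer (driftFree T y₀) hmin
  rw [← hu] at hort
  have hort' : inner ℝ u (Complex.I • v) = 0 := by
    rw [← sub_add_cancel (Complex.I • v) (driftFree T y₀ (Complex.I • v)), inner_add_right, hort,
      add_zero, real_inner_comm]
    exact (Submodule.mem_orthogonal _ _).1 humem _ (sub_driftFree_mem T y₀ _)
  -- In ⟨u, i(y₀ + w + u)⟩ = 0 the last term vanishes, so ⟨u, iy₀⟩ = -⟨u, iw⟩.
  have hin : |inner ℝ u (Complex.I • y₀)| ≤ ‖w‖ * ‖u‖ := by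
    rw [hveq, smul_add, smul_add, inner_add_right, inner_add_right,
      real_inner_euclidean_I_smul_self, add_zero] at hort'
    rw [eq_neg_of_add_eq_zero_left hort', abs_neg]
    refine (abs_real_inner_le_norm _ _).trans ?_
    rw [norm_smul, Complex.norm_I, one_mul, mul_comm]
  have hkey := hK w hwmem u humem hin (by linarith) (by linarith)
  rw [← hveq] at hkey
  have hfit : fdrMap T (magnitudes T x₀) v = α • fdrMap T (magnitudes T x₀) y :=
    fdrMap_smul (fitData_smul (hnz y (hy.trans (min_le_left _ _))) hα.1)
  constructor
  · rw [← hfit]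
    have : fdrMap T (magnitudes T x₀) v - y₀ =
      (fdrMap T (magnitudes T x₀) v - (y₀ + w)) + w := by abel
    rw [this, map_add, driftFree_eq_zero hwmem, add_zero]
    exact (norm_driftFree_le T y₀ _).trans hkey
  · have h2 : ‖fdrMap T (magnitudes T x₀) y - y‖ = ‖fdrMap T (magnitudes T x₀) v - v‖ := by
      rw [hfit, hv, ← smul_sub, norm_smul, hα.1, one_mul]
    have h3 : fdrMap T (magnitudes T x₀) v - v =
        (fdrMap T (magnitudes T x₀) v - (y₀ + w)) - u := by
      conv_lhs => rw [sub_eq_add_neg]; arg 2; rw [hveq]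
      abel
    rw [h2, h3]
    refine (norm_sub_le _ _).trans ?_
    nlinarith [norm_nonneg u]

/-- A annihilates `fixedDir`, so the object estimate does not see the drift. -/
theorem IsIsometric.norm_smul_conjTranspose_sub_le (hT : IsIsometric T) (x₀ : EuclideanSpace ℂ ι)
    (y : EuclideanSpace ℂ κ) (α : ℂ) :
    ‖α • Tᴴ.toEuclideanLin y - x₀‖ ≤
      ‖driftFree T (T.toEuclideanLin x₀) (α • y - T.toEuclideanLin x₀)‖ := by
  set y₀ := T.toEuclideanLin x₀ with hy₀
  have h1 : α • Tᴴ.toEuclideanLin y - x₀ =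
      Tᴴ.toEuclideanLin (driftFree T y₀ (α • y - y₀)) := by
    have h2 := (mem_fixedDir.1 (sub_driftFree_mem T y₀ (α • y - y₀))).1
    rw [map_sub, sub_eq_zero] at h2
    rw [← h2, map_sub, map_smul, hy₀, hT.conjTranspose_apply_apply]
  rw [h1]
  exact hT.norm_conjTranspose_apply_le _

/-- Local geometric convergence of the Fourier-domain Douglas–Rachford iteration, in the data
space, for an isometric propagation matrix with the rigidity property. -/
theorem IsIsometric.exists_fdr_convergence (hT : IsIsometric T) {x₀ : EuclideanSpace ℂ ι}
    (hx₀ : HasRigidPhase T x₀) (hne : x₀ ≠ 0) :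
    ∃ γ : ℝ, 0 ≤ γ ∧ γ < 1 ∧ ∃ δ : ℝ, 0 < δ ∧
      ∀ y : ℕ → EuclideanSpace ℂ κ, IsFDRSequence T x₀ y →
        ‖y 1 - T.toEuclideanLin x₀‖ < δ →
        ∀ k : ℕ, 1 ≤ k → ∃ α : ℂ, IsOptimalPhase (Tᴴ.toEuclideanLin (y k)) x₀ α ∧
          ‖α • Tᴴ.toEuclideanLin (y k) - x₀‖ ≤
            γ ^ (k - 1) * ‖y 1 - T.toEuclideanLin x₀‖ := by
  obtain ⟨γ, ε, h0, h1, hε, hstep⟩ := hT.exists_fdrMap_contraction hx₀ hne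
  set y₀ := T.toEuclideanLin x₀ with hy₀
  have hγ : 0 < 1 - γ := by linarith
  -- Steps have length at most 2γᵏd, so the total displacement is at most 2d/(1-γ).
  refine ⟨γ, h0, h1, ε / (1 + 2 / (1 - γ)), by positivity, fun y hy hδ => ?_⟩
  choose a ha using fun k => exists_isOptimalDataPhase T y₀ (y k)
  set d := ‖y 1 - y₀‖ with hd
  have hd0 : 0 ≤ d := norm_nonneg _
  have hdε : d * (1 + 2 / (1 - γ)) ≤ ε := ((lt_div_iff₀ (by positivity)).1 hδ).le
  have main : ∀ k : ℕ, ‖driftFree T y₀ (a (k + 1) • y (k + 1) - y₀)‖ ≤ γ ^ k * d ∧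
      ‖y (k + 1) - y₀‖ ≤ d * (1 + 2 / (1 - γ) * (1 - γ ^ k)) := by
    intro k
    induction k with
    | zero =>
      constructor
      · have := (ha 1).2 1 norm_one
        rw [one_smul] at this
        simpa using this.trans (norm_driftFree_le T y₀ _)
      · simp [hd]
    | succ k ih =>
      have hpk : 0 ≤ γ ^ k := pow_nonneg h0 k
      have hball : ‖y (k + 1) - y₀‖ ≤ ε := by
        refine ih.2.trans (le_trans ?_ hdε)
        refine mul_le_mul_of_nonneg_left ?_ hd0
        have : 2 / (1 - γ) * (1 - γ ^ k) ≤ 2 / (1 - γ) * 1 := by gcongr; linarith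
        linarith
      obtain ⟨hA, hB⟩ := hstep _ _ hball (ha (k + 1))
      rw [← hy (k + 1) (by omega)] at hA hB
      constructor
      -- The best phase of the new iterate does at least as well as the phase of the previous one.
      · calc _ ≤ _ := (ha (k + 1 + 1)).2 _ (ha (k + 1)).1
          _ ≤ _ := hA
          _ ≤ γ * (γ ^ k * d) := mul_le_mul_of_nonneg_left ih.1 h0
          _ = _ := by ring
      · calc ‖y (k + 1 + 1) - y₀‖ = ‖(y (k + 1 + 1) - y (k + 1)) + (y (k + 1) - y₀)‖ := by
              rw [sub_add_sub_cancel]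
          _ ≤ ‖y (k + 1 + 1) - y (k + 1)‖ + ‖y (k + 1) - y₀‖ := norm_add_le _ _
          _ ≤ 2 * (γ ^ k * d) + d * (1 + 2 / (1 - γ) * (1 - γ ^ k)) :=
              add_le_add (hB.trans (by linarith [ih.1])) ih.2
          _ = _ := by field_simp; ring
  intro k hk
  obtain ⟨k, rfl⟩ : ∃ m, k = m + 1 := ⟨k - 1, by omega⟩
  obtain ⟨α, hα⟩ := exists_isOptimalPhase (Tᴴ.toEuclideanLin (y (k + 1))) x₀
  refine ⟨α, hα, (hα.2 _ (ha (k + 1)).1).trans ?_⟩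
  exact (hT.norm_smul_conjTranspose_sub_le x₀ _ _).trans (main k).1

end Dynamics

/-! ### Extreme coefficients of polynomials -/

section ExtremeCoefficients

open Polynomial

/-- `q` has degree at most `n`, and its coefficient of degree `n` is `c`. -/
def IsTopCoeff (q : ℂ[X]) (n : ℕ) (c : ℂ) : Prop := q.natDegree ≤ n ∧ q.coeff n = c

/-- `q` is divisible by `X ^ n`, and its coefficient of degree `n` is `c`. -/
def IsBotCoeff (q : ℂ[X]) (n : ℕ) (c : ℂ) : Prop := ∃ r, q = X ^ n * r ∧ r.coeff 0 = c

namespace IsTopCoeff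

variable {q q' : ℂ[X]} {n n' : ℕ} {c c' : ℂ}

theorem mul (h : IsTopCoeff q n c) (h' : IsTopCoeff q' n' c') :
    IsTopCoeff (q * q') (n + n') (c * c') := by
  refine ⟨natDegree_mul_le_of_le h.1 h'.1, ?_⟩
  rw [coeff_mul_add_eq_of_natDegree_le h.1 h'.1, h.2, h'.2]

theorem add (h : IsTopCoeff q n c) (h' : IsTopCoeff q' n c') :
    IsTopCoeff (q + q') n (c + c') :=
  ⟨natDegree_add_le_of_degree_le h.1 h'.1, by rw [coeff_add, h.2, h'.2]⟩

theorem of_lt (h : IsTopCoeff q n c) (hn : n < n') : IsTopCoeff q n' 0 :=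
  ⟨h.1.trans hn.le, coeff_eq_zero_of_natDegree_lt (h.1.trans_lt hn)⟩

theorem C_mul (h : IsTopCoeff q n c) (a : ℂ) : IsTopCoeff (C a * q) n (a * c) := by
  refine ⟨(natDegree_C_mul_le a q).trans h.1, ?_⟩
  rw [coeff_C_mul, h.2]

theorem unique (h : IsTopCoeff q n c) (h' : IsTopCoeff q n' c') (hc : c ≠ 0) (hc' : c' ≠ 0) :
    n = n' ∧ c = c' := by
  have h1 : n = n' := by
    rcases lt_trichotomy n n' with hl | hl | hl
    · exact absurd (h'.2.symm.trans (h.of_lt hl).2) hc'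
    · exact hl
    · exact absurd (h.2.symm.trans (h'.of_lt hl).2) hc
  subst h1
  exact ⟨rfl, h.2.symm.trans h'.2⟩

end IsTopCoeff

theorem isTopCoeff_X_pow (n : ℕ) : IsTopCoeff (X ^ n : ℂ[X]) n 1 :=
  ⟨(natDegree_X_pow n).le, by simp⟩

namespace IsBotCoeff

variable {q q' : ℂ[X]} {n n' : ℕ} {c c' : ℂ}

theorem mul (h : IsBotCoeff q n c) (h' : IsBotCoeff q' n' c') :
    IsBotCoeff (q * q') (n + n') (c * c') := by
  obtain ⟨r, rfl, rfl⟩ := h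
  obtain ⟨r', rfl, rfl⟩ := h'
  exact ⟨r * r', by ring, mul_coeff_zero r r'⟩

theorem add (h : IsBotCoeff q n c) (h' : IsBotCoeff q' n c') :
    IsBotCoeff (q + q') n (c + c') := by
  obtain ⟨r, rfl, rfl⟩ := h
  obtain ⟨r', rfl, rfl⟩ := h'
  exact ⟨r + r', by ring, coeff_add r r' 0⟩

theorem of_lt (h : IsBotCoeff q n c) (hn : n' < n) : IsBotCoeff q n' 0 := by
  obtain ⟨r, rfl, rfl⟩ := h
  refine ⟨X ^ (n - n') * r, ?_, ?_⟩
  · rw [← mul_assoc, ← pow_add, Nat.add_sub_cancel' hn.le]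
  · rw [mul_coeff_zero, coeff_X_pow, if_neg (by omega), zero_mul]

theorem C_mul (h : IsBotCoeff q n c) (a : ℂ) : IsBotCoeff (C a * q) n (a * c) := by
  obtain ⟨r, rfl, rfl⟩ := h
  exact ⟨C a * r, by ring, by simp⟩

theorem coeff_eq (h : IsBotCoeff q n c) : q.coeff n = c := by
  obtain ⟨r, rfl, rfl⟩ := h
  simpa using coeff_X_pow_mul r n 0

theorem unique (h : IsBotCoeff q n c) (h' : IsBotCoeff q n' c') (hc : c ≠ 0) (hc' : c' ≠ 0) :
    n = n' ∧ c = c' := by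
  have h1 : n = n' := by
    rcases lt_trichotomy n n' with hl | hl | hl
    · exact absurd (h.coeff_eq.symm.trans (h'.of_lt hl).coeff_eq) hc
    · exact hl
    · exact absurd (h'.coeff_eq.symm.trans (h.of_lt hl).coeff_eq) hc'
  subst h1
  exact ⟨rfl, h.coeff_eq.symm.trans h'.coeff_eq⟩

end IsBotCoeff

theorem isBotCoeff_X_pow (n : ℕ) : IsBotCoeff (X ^ n : ℂ[X]) n 1 := ⟨1, by simp, by simp⟩

theorem exists_isBotCoeff {q : ℂ[X]} (hq : q ≠ 0) : ∃ n c, c ≠ 0 ∧ IsBotCoeff q n c := by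
  obtain ⟨r, hr, hd⟩ := exists_eq_pow_rootMultiplicity_mul_and_not_dvd q hq 0
  rw [C_0, sub_zero] at hr hd
  exact ⟨_, r.coeff 0, fun h => hd (X_dvd_iff.2 h), r, hr, rfl⟩

theorem eq_monomial_of_isTopCoeff_of_isBotCoeff {q : ℂ[X]} {n : ℕ} {c c' : ℂ}
    (h : IsTopCoeff q n c) (h' : IsBotCoeff q n c') : q = C c * X ^ n := by
  have hc : c' = c := h'.coeff_eq.symm.trans h.2
  obtain ⟨r, rfl, rfl⟩ := h'
  have hr : r.natDegree = 0 := by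
    by_cases h0 : r = 0
    · simp [h0]
    · have := h.1
      rw [natDegree_mul (pow_ne_zero _ X_ne_zero) h0, natDegree_X_pow] at this
      omega
  rw [eq_C_of_natDegree_eq_zero hr, ← hc, mul_comm]

end ExtremeCoefficients

/-! ### Uniqueness for two masks differing at one pixel -/

section GeneratingPolynomial

open Polynomial

variable {ι : Type*} [Fintype ι]

/-- The polynomial `∑ f m X ^ (e m)`. -/
noncomputable def genPoly (e : ι → ℕ) (f : ι → ℂ) : ℂ[X] := ∑ m, C (f m) * X ^ e m

theorem genPoly_coeff {e : ι → ℕ} (he : Function.Injective e) (f : ι → ℂ) (m : ι) :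
    (genPoly e f).coeff (e m) = f m := by
  classical
  simp [genPoly, coeff_X_pow, he.eq_iff]

theorem genPoly_eq_zero {e : ι → ℕ} (he : Function.Injective e) {f : ι → ℂ}
    (h : genPoly e f = 0) : f = 0 := by
  ext m
  rw [← genPoly_coeff he f m, h]
  simp

theorem isTopCoeff_genPoly {e : ι → ℕ} (he : Function.Injective e) {f : ι → ℂ} {p : ι}
    (hp : ∀ m, f m ≠ 0 → e m ≤ e p) : IsTopCoeff (genPoly e f) (e p) (f p) := by
  refine ⟨natDegree_sum_le_of_forall_le _ _ fun m _ => ?_, genPoly_coeff he f p⟩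
  by_cases hm : f m = 0
  · simp [hm]
  · exact (natDegree_C_mul_X_pow_le _ _).trans (hp m hm)

theorem isBotCoeff_genPoly {e : ι → ℕ} (he : Function.Injective e) {f : ι → ℂ} {r : ι}
    (hr : ∀ m, f m ≠ 0 → e r ≤ e m) : IsBotCoeff (genPoly e f) (e r) (f r) := by
  have h : genPoly e f = X ^ e r * ∑ m, C (f m) * X ^ (e m - e r) := by
    rw [genPoly, Finset.mul_sum]
    refine Finset.sum_congr rfl fun m _ => ?_
    by_cases hm : f m = 0
    · simp [hm]
    · rw [mul_left_comm, ← pow_add, Nat.add_sub_cancel' (hr m hm)]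
  refine ⟨_, h, ?_⟩
  have h2 := genPoly_coeff he f r
  rw [h] at h2
  rw [← h2]
  exact ((congrArg _ (zero_add (e r)).symm).trans (coeff_X_pow_mul _ (e r) 0)).symm

theorem genPoly_mul_update [DecidableEq ι] (e : ι → ℕ) (f : ι → ℂ) (p : ι) (t : ℂ) :
    genPoly e (fun m => f m * if m = p then t else 1) =
      genPoly e f + C ((t - 1) * f p) * X ^ e p := by
  have h : C ((t - 1) * f p) * X ^ e p =
      ∑ m, if m = p then C ((t - 1) * f m) * X ^ e m else 0 := by simp
  rw [h, genPoly, genPoly, ← Finset.sum_add_distrib]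
  refine Finset.sum_congr rfl fun m _ => ?_
  split_ifs with hm
  · simp only [map_mul, map_sub, map_one]; ring
  · simp

variable {e : ι → ℕ} {K : ℕ} {g g' : ι → ℂ} {p r : ι}

/-- The divisor in the elimination of `F'` from the relations for two masks that differ at the
pixel `p` only. -/
noncomputable def elimDivisor (e : ι → ℕ) (K : ℕ) (g g' : ι → ℂ) (p : ι) (t : ℂ) : ℂ[X] :=
  C (g' p) * (X ^ (K - e p) * genPoly e g) +
    C (t * g p) * (X ^ e p * genPoly (fun m => K - e m) g')

theorem injective_sub {e : ι → ℕ} (he : Function.Injective e) {K : ℕ} (hK : ∀ m, e m ≤ K) :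
    Function.Injective fun m => K - e m := by
  intro a b hab
  have h1 := hK a
  have h2 := hK b
  simp only at hab
  exact he (by omega)

/-- Since e r < e p, only the second summand reaches the top degree; dually, only the first reaches
the bottom degree. -/
theorem isTopCoeff_elimDivisor (he : Function.Injective e) (hK : ∀ m, e m ≤ K)
    (hsupp : ∀ m, g' m = 0 ↔ g m = 0) (hp : ∀ m, g m ≠ 0 → e m ≤ e p)
    (hr : ∀ m, g m ≠ 0 → e r ≤ e m) (hlt : e r < e p) (t : ℂ) :
    IsTopCoeff (elimDivisor e K g g' p t) (e p + (K - e r)) (t * g p * g' r) := by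
  have hG := isTopCoeff_genPoly he hp
  have hG' : IsTopCoeff (genPoly (fun m => K - e m) g') (K - e r) (g' r) :=
    isTopCoeff_genPoly (p := r) (injective_sub he hK) fun m hm =>
      Nat.sub_le_sub_left (hr m (mt (hsupp m).2 hm)) K
  have hpK := hK p
  have h1 := (((isTopCoeff_X_pow (K - e p)).mul hG).C_mul (g' p)).of_lt
    (n' := e p + (K - e r)) (by omega)
  have h2 := ((isTopCoeff_X_pow (e p)).mul hG').C_mul (t * g p)
  simpa [elimDivisor] using h1.add h2

theorem isBotCoeff_elimDivisor (he : Function.Injective e) (hK : ∀ m, e m ≤ K)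
    (hsupp : ∀ m, g' m = 0 ↔ g m = 0) (hp : ∀ m, g m ≠ 0 → e m ≤ e p)
    (hr : ∀ m, g m ≠ 0 → e r ≤ e m) (hlt : e r < e p) (t : ℂ) :
    IsBotCoeff (elimDivisor e K g g' p t) (K - e p + e r) (g' p * g r) := by
  have hG := isBotCoeff_genPoly he hr
  have hG' : IsBotCoeff (genPoly (fun m => K - e m) g') (K - e p) (g' p) :=
    isBotCoeff_genPoly (r := p) (injective_sub he hK) fun m hm =>
      Nat.sub_le_sub_left (hp m (mt (hsupp m).2 hm)) K
  have hpK := hK p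
  have h1 := ((isBotCoeff_X_pow (K - e p)).mul hG).C_mul (g' p)
  have h2 := (((isBotCoeff_X_pow (e p)).mul hG').C_mul (t * g p)).of_lt
    (n' := K - e p + e r) (by omega)
  simpa [elimDivisor] using h1.add h2

/-- A solution `(F, F')` of the two relations with `f' p ≠ 0` forces an identity between the
generating polynomials of `g` and `g'`. -/
theorem elim_identity (he : Function.Injective e) (hK : ∀ m, e m ≤ K)
    (hsupp : ∀ m, g' m = 0 ↔ g m = 0) (hgp : g p ≠ 0) (hgr : g r ≠ 0)
    (hp : ∀ m, g m ≠ 0 → e m ≤ e p)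
    (hr : ∀ m, g m ≠ 0 → e r ≤ e m) (hlt : e r < e p) {t c : ℂ} (ht : t ≠ 0) (hc : c ≠ 0)
    {F : ℂ[X]}
    (h : F * elimDivisor e K g g' p t =
      C (-c) * (genPoly e g * (X ^ (K - e p) * genPoly e g + C ((t - 1) * g p) * X ^ K))) :
    C (g r) * X ^ e r * elimDivisor e K g g' p t =
      C (g' p) *
        (genPoly e g * (X ^ (K - e p) * genPoly e g + C ((t - 1) * g p) * X ^ K)) := by
  have hpK := hK p
  have hg'p : g' p ≠ 0 := mt (hsupp p).1 hgp
  have hg'r : g' r ≠ 0 := mt (hsupp r).1 hgr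
  have hDtop := isTopCoeff_elimDivisor he hK hsupp hp hr hlt t
  have hDbot := isBotCoeff_elimDivisor he hK hsupp hp hr hlt t
  have hGtop := isTopCoeff_genPoly he hp
  have hGbot := isBotCoeff_genPoly he hr
  have hEtop : IsTopCoeff (X ^ (K - e p) * genPoly e g + C ((t - 1) * g p) * X ^ K) K
      (t * g p) := by
    have h1 := (isTopCoeff_X_pow (K - e p)).mul hGtop
    rw [Nat.sub_add_cancel hpK] at h1
    have h2 := h1.add ((isTopCoeff_X_pow K).C_mul ((t - 1) * g p))
    convert h2 using 1
    ring
  have hEbot : IsBotCoeff (X ^ (K - e p) * genPoly e g + C ((t - 1) * g p) * X ^ K)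
      (K - e p + e r) (g r) := by
    have h1 := (isBotCoeff_X_pow (K - e p)).mul hGbot
    have h2 := h1.add (((isBotCoeff_X_pow K).C_mul ((t - 1) * g p)).of_lt (by omega))
    simpa using h2
  have hRtop := (hGtop.mul hEtop).C_mul (-c)
  have hRbot := (hGbot.mul hEbot).C_mul (-c)
  rw [← h] at hRtop hRbot
  have hF : F ≠ 0 := by
    rintro rfl
    rw [zero_mul] at hRtop
    have := hRtop.2
    rw [coeff_zero] at this
    exact (mul_ne_zero (neg_ne_zero.2 hc) (mul_ne_zero hgp (mul_ne_zero ht hgp))) this.symm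
  have hFtop : IsTopCoeff F F.natDegree F.leadingCoeff := ⟨le_rfl, rfl⟩
  obtain ⟨n, a, ha, hFbot⟩ := exists_isBotCoeff hF
  obtain ⟨h1, -⟩ := (hFtop.mul hDtop).unique hRtop
    (mul_ne_zero (leadingCoeff_ne_zero.2 hF) (mul_ne_zero (mul_ne_zero ht hgp) hg'r))
    (mul_ne_zero (neg_ne_zero.2 hc) (mul_ne_zero hgp (mul_ne_zero ht hgp)))
  obtain ⟨h2, h3⟩ := (hFbot.mul hDbot).unique hRbot
    (mul_ne_zero ha (mul_ne_zero hg'p hgr))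
    (mul_ne_zero (neg_ne_zero.2 hc) (mul_ne_zero hgr hgr))
  -- The lowest exponent and the degree of F are both e r, so F is a monomial.
  have hn : n = e r := by omega
  have hdeg : F.natDegree = e r := by omega
  rw [hdeg] at hFtop
  subst hn
  have hFeq := eq_monomial_of_isTopCoeff_of_isBotCoeff hFtop hFbot
  have hla : F.leadingCoeff = a := hFtop.2.symm.trans hFbot.coeff_eq
  rw [hla] at hFeq
  have h4 : a * g' p = -c * g r := by
    have : (a * g' p - -c * g r) * g r = 0 := by linear_combination h3
    exact sub_eq_zero.1 ((mul_eq_zero.1 this).resolve_right hgr)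
  have h5 : C a * C (g' p) = C (-c) * C (g r) := by rw [← C_mul, h4, C_mul]
  have hcC : C (-c) ≠ 0 := C_ne_zero.2 (neg_ne_zero.2 hc)
  -- Inserting the monomial and cancelling -c removes the unknown F from the relation.
  refine mul_left_cancel₀ hcC ?_
  rw [hFeq] at h
  linear_combination C (g' p) * h - X ^ e r * elimDivisor e K g g' p t * h5

/-- The identity is affine in t, so two values isolate its constant part, which is the claim
multiplied by the nonzero factor g'(p) G X^(K - e p). -/
theorem eq_binomial_of_elim_identity (hK : ∀ m, e m ≤ K)
    (hgp : g p ≠ 0) (hg'p : g' p ≠ 0) (hG : genPoly e g ≠ 0) {t₁ t₂ : ℂ} (ht : t₁ ≠ t₂)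
    (h : ∀ t, t = t₁ ∨ t = t₂ → C (g r) * X ^ e r * elimDivisor e K g g' p t =
      C (g' p) *
        (genPoly e g * (X ^ (K - e p) * genPoly e g + C ((t - 1) * g p) * X ^ K))) :
    genPoly e g = C (g r) * X ^ e r + C (g p) * X ^ e p := by
  have h1 := h t₁ (Or.inl rfl)
  have h2 := h t₂ (Or.inr rfl)
  have hZ : (X : ℂ[X]) ^ K = X ^ (K - e p) * X ^ e p := by
    rw [← pow_add, Nat.sub_add_cancel (hK p)]
  set G := genPoly e g
  set G' := genPoly (fun m => K - e m) g' with hG'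
  simp only [elimDivisor, map_mul, map_sub, map_one, ← hG', hZ] at h1 h2
  have hne : C (g p) * (C t₁ - C t₂) ≠ 0 :=
    mul_ne_zero (C_ne_zero.2 hgp) (sub_ne_zero.2 fun h' => ht (C_injective h'))
  have h3 : C (g r) * X ^ e r * X ^ e p * G' = C (g' p) * G * (X ^ (K - e p) * X ^ e p) := by
    refine mul_left_cancel₀ hne ?_
    linear_combination h1 - h2
  have hne2 : C (g' p) * G * X ^ (K - e p) ≠ 0 :=
    mul_ne_zero (mul_ne_zero (C_ne_zero.2 hg'p) hG) (pow_ne_zero _ X_ne_zero)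
  refine mul_left_cancel₀ hne2 ?_
  linear_combination -h1 + C t₁ * C (g p) * h3

/-- For two masks that differ at one extreme pixel `p` of the support of `g` only, the bilinear
relations determine `(f, f')` up to the trivial solutions. -/
theorem exists_unique_mask [DecidableEq ι] (he : Function.Injective e) (hK : ∀ m, e m ≤ K)
    (hsupp : ∀ m, g' m = 0 ↔ g m = 0) (hgp : g p ≠ 0) (hp : ∀ m, g m ≠ 0 → e m ≤ e p)
    (hcard : ∀ a b, ∃ m, g m ≠ 0 ∧ m ≠ a ∧ m ≠ b) :
    ∃ t : ℂ, t ≠ 0 ∧ ∀ f f' : ι → ℂ, f p = 0 →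
      genPoly e f * genPoly (fun m => K - e m) g' +
        genPoly (fun m => K - e m) f' * genPoly e g = 0 →
      genPoly e (fun m => f m * if m = p then t else 1) *
          genPoly (fun m => K - e m) (fun m => g' m * if m = p then t⁻¹ else 1) +
        genPoly (fun m => K - e m) (fun m => f' m * if m = p then t⁻¹ else 1) *
          genPoly e (fun m => g m * if m = p then t else 1) = 0 →
      f = 0 ∧ f' = 0 := by
  have he' := injective_sub he hK
  obtain ⟨r, hgr, hr⟩ : ∃ r, g r ≠ 0 ∧ ∀ m, g m ≠ 0 → e r ≤ e m := by
    obtain ⟨r, hr, hmin⟩ := Finset.exists_min_image (Finset.univ.filter fun m => g m ≠ 0) e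
      ⟨p, by simp [hgp]⟩
    exact ⟨r, by simpa using hr, fun m hm => hmin m (by simp [hm])⟩
  have hlt : e r < e p := by
    obtain ⟨m, hm, hmp, -⟩ := hcard p p
    exact (hr m hm).trans_lt (lt_of_le_of_ne (hp m hm) fun h => hmp (he h))
  have hg'p : g' p ≠ 0 := mt (hsupp p).1 hgp
  have hg'r : g' r ≠ 0 := mt (hsupp r).1 hgr
  have hG : genPoly e g ≠ 0 := fun h => hgp (congrFun (genPoly_eq_zero he h) p)
  by_contra! hcon
  -- Each failing t brings its own nontrivial solution, yet all lead to an identity free of that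
  -- solution.
  have key : ∀ t : ℂ, t ≠ 0 → t ≠ 1 → C (g r) * X ^ e r * elimDivisor e K g g' p t =
      C (g' p) *
        (genPoly e g * (X ^ (K - e p) * genPoly e g + C ((t - 1) * g p) * X ^ K)) := by
    intro t ht0 ht1
    obtain ⟨f, f', hfp, h1, h2, hne⟩ := hcon t ht0
    rw [genPoly_mul_update, genPoly_mul_update, genPoly_mul_update, genPoly_mul_update, hfp] at h2
    have hZ : (X : ℂ[X]) ^ K = X ^ (K - e p) * X ^ e p := by
      rw [← pow_add, Nat.sub_add_cancel (hK p)]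
    have hst : C t⁻¹ * C t = (1 : ℂ[X]) := by rw [← C_mul, inv_mul_cancel₀ ht0, C_1]
    have htC : C t - 1 ≠ (0 : ℂ[X]) := by
      rw [← C_1, ← C_sub]; exact C_ne_zero.2 (sub_ne_zero.2 ht1)
    have h3 : genPoly e f * elimDivisor e K g g' p t = C (-f' p) *
        (genPoly e g * (X ^ (K - e p) * genPoly e g + C ((t - 1) * g p) * X ^ K)) := by
      refine mul_left_cancel₀ htC ?_
      simp only [elimDivisor, map_mul, map_sub, map_one, map_zero, mul_zero, zero_mul, add_zero,
        hZ, map_neg] at h2 ⊢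
      set F := genPoly e f
      set F' := genPoly (fun m => K - e m) f'
      set G := genPoly e g
      set G' := genPoly (fun m => K - e m) g'
      set P := (X : ℂ[X]) ^ e p
      set P' := (X : ℂ[X]) ^ (K - e p)
      -- The second relation is multiplied by G, and F'G is replaced by -FG' from the first.
      linear_combination (-C t * G) * h2 + (C t * G + C t * (C t - 1) * C (g p) * P) * h1 +
        (G * (F * C (g' p) * P' + C (f' p) * P' * (G + (C t - 1) * C (g p) * P))) * hst
    by_cases hc : f' p = 0
    · exfalso
      rw [hc, neg_zero, C_0, zero_mul] at h3
      have hD : elimDivisor e K g g' p t ≠ 0 := fun h0 => by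
        have := (isTopCoeff_elimDivisor he hK hsupp hp hr hlt t).2
        rw [h0, coeff_zero] at this
        exact mul_ne_zero (mul_ne_zero ht0 hgp) hg'r this.symm
      have hF := (mul_eq_zero.1 h3).resolve_right hD
      rw [hF, zero_mul, zero_add] at h1
      have hF' := (mul_eq_zero.1 h1).resolve_right hG
      exact hne (genPoly_eq_zero he hF) (genPoly_eq_zero he' hF')
    · exact elim_identity he hK hsupp hgp hgr hp hr hlt ht0 hc h3
  have hbin := eq_binomial_of_elim_identity (r := r) hK hgp hg'p hG
    (show (2 : ℂ) ≠ 3 by norm_num) (by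
      rintro t (rfl | rfl)
      · exact key 2 (by norm_num) (by norm_num)
      · exact key 3 (by norm_num) (by norm_num))
  obtain ⟨m, hm, hmp, hmr⟩ := hcard p r
  apply hm
  rw [← genPoly_coeff he g m, hbin, coeff_add, coeff_C_mul, coeff_C_mul, coeff_X_pow,
    coeff_X_pow, if_neg fun h => hmr (he h), if_neg fun h => hmp (he h)]
  simp

end GeneratingPolynomial

/-! ### From oversampled frequencies to polynomial identities -/

section Fourier

open Polynomial

theorem sum_exp_eq_ite (m : ℕ) {k : ℤ} (hk : |k| ≤ 2 * m) :
    ∑ j : Fin (2 * m + 1), Complex.exp (2 * Real.pi * Complex.I * (k * ((j : ℕ) / (2 * m + 1)))) =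
      if k = 0 then 2 * (m : ℂ) + 1 else 0 := by
  have hN : (2 * (m : ℂ) + 1) ≠ 0 := by exact_mod_cast (Nat.succ_ne_zero (2 * m))
  split_ifs with h0
  · subst h0
    simp
  · set ζ := Complex.exp (2 * Real.pi * Complex.I * (k / (2 * m + 1))) with hζ
    have hpow : ∀ j : ℕ, Complex.exp (2 * Real.pi * Complex.I * (k * (j / (2 * m + 1)))) = ζ ^ j := by
      intro j
      rw [hζ, ← Complex.exp_nat_mul]
      congr 1
      ring
    have hne : ζ ≠ 1 := by
      rw [hζ, Ne, Complex.exp_eq_one_iff]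
      rintro ⟨n, hn⟩
      have h1 : (k : ℂ) = n * (2 * m + 1) := by
        have h2 : (k : ℂ) / (2 * m + 1) = n := by
          refine mul_left_cancel₀ Complex.two_pi_I_ne_zero ?_
          rw [hn]; ring
        rw [← h2, div_mul_cancel₀ _ hN]
      have h3 : k = n * (2 * m + 1) := by exact_mod_cast h1
      have hn0 : n ≠ 0 := by rintro rfl; simp at h3; exact h0 h3
      have h4 : 1 ≤ |n| := Int.one_le_abs hn0
      rw [h3, abs_mul, abs_of_nonneg (by positivity : (0 : ℤ) ≤ 2 * m + 1)] at hk
      nlinarith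
    have hone : ζ ^ (2 * m + 1) = 1 := by
      rw [← hpow, Complex.exp_eq_one_iff]
      refine ⟨k, ?_⟩
      push_cast
      rw [div_self hN]
      ring
    rw [Finset.sum_congr rfl fun (j : Fin (2 * m + 1)) _ => hpow j,
      Fin.sum_univ_eq_sum_range (fun j => ζ ^ j), geom_sum_eq hne, hone, sub_self, zero_div]

variable {d : ℕ} {M : Fin d → ℕ}

theorem oversampledDFT_apply (p : FreqGrid M) (n : ObjGrid M) :
    oversampledDFT M p n = Complex.exp (-(2 * Real.pi * Complex.I *
      ∑ i, ((n i : ℕ) : ℂ) * (((p i : ℕ) : ℂ) / (2 * (M i : ℂ) + 1)))) := rfl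

theorem star_oversampledDFT_apply (p : FreqGrid M) (n : ObjGrid M) :
    star (oversampledDFT M p n) = Complex.exp (2 * Real.pi * Complex.I *
      ∑ i, ((n i : ℕ) : ℂ) * (((p i : ℕ) : ℂ) / (2 * (M i : ℂ) + 1))) := by
  rw [oversampledDFT_apply, Complex.star_def, ← Complex.exp_conj]
  simp [Complex.conj_ofNat]

/-- Two pixel differences differ by at most 2Mᵢ in coordinate i, so 2Mᵢ + 1 frequencies separate
them. -/
theorem sum_oversampledDFT (a b a₀ b₀ : ObjGrid M) :
    ∑ p : FreqGrid M, oversampledDFT M p a * star (oversampledDFT M p b) *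
      (star (oversampledDFT M p a₀) * oversampledDFT M p b₀) =
      if (fun i => ((a i : ℕ) : ℤ) - (b i : ℕ)) = fun i => ((a₀ i : ℕ) : ℤ) - (b₀ i : ℕ) then
        ∏ i, (2 * (M i : ℂ) + 1) else 0 := by
  set k : Fin d → ℤ := fun i => -(((a i : ℕ) : ℤ) - (b i : ℕ) - ((a₀ i : ℕ) - (b₀ i : ℕ))) with hk
  have hterm : ∀ p : FreqGrid M, oversampledDFT M p a * star (oversampledDFT M p b) *
      (star (oversampledDFT M p a₀) * oversampledDFT M p b₀) =
      ∏ i, Complex.exp (2 * Real.pi * Complex.I * (k i * ((p i : ℕ) / (2 * M i + 1)))) := by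
    intro p
    rw [star_oversampledDFT_apply, star_oversampledDFT_apply, oversampledDFT_apply,
      oversampledDFT_apply, ← Complex.exp_add, ← Complex.exp_add, ← Complex.exp_add,
      ← Complex.exp_sum, ← Finset.mul_sum]
    congr 1
    simp only [hk]
    push_cast
    simp only [sub_mul, neg_mul, Finset.sum_sub_distrib, Finset.sum_neg_distrib]
    ring
  have hbound : ∀ i, |k i| ≤ 2 * (M i : ℕ) := by
    intro i
    have h1 := (a i).2
    have h2 := (b i).2
    have h3 := (a₀ i).2
    have h4 := (b₀ i).2
    rw [abs_le]
    simp only [hk]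
    omega
  rw [Finset.sum_congr rfl fun p _ => hterm p]
  have hprod := (Finset.prod_univ_sum (fun i => (Finset.univ : Finset (Fin (2 * M i + 1))))
    fun i j => Complex.exp (2 * Real.pi * Complex.I * (k i * ((j : ℕ) / (2 * M i + 1))))).symm
  rw [Fintype.piFinset_univ] at hprod
  rw [hprod, Finset.prod_congr rfl fun i _ => sum_exp_eq_ite (M i) (hbound i)]
  split_ifs with h
  · refine Finset.prod_congr rfl fun i _ => ?_
    rw [if_pos]
    have := congrFun h i
    simp only [hk]
    omega
  · obtain ⟨i, hi⟩ := Function.ne_iff.1 h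
    refine Finset.prod_eq_zero (Finset.mem_univ i) ?_
    rw [if_neg]
    simp only [hk]
    omega

/-- The mixed-radix encoding of the pixels of the object grid. -/
def pixelCode (n : ObjGrid M) : ℕ := (finPiFinEquiv n : ℕ)

theorem pixelCode_injective : Function.Injective (pixelCode (M := M)) :=
  Fin.val_injective.comp finPiFinEquiv.injective

theorem pixelCode_le (n : ObjGrid M) : pixelCode n ≤ ∏ i, (M i + 1) :=
  (finPiFinEquiv n).2.le

/-- The code is linear in the digits, so the exponent depends only on a - b. Distinct differences
may share an exponent; this is harmless, as each group of terms vanishes separately. -/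
theorem pixelCode_add_eq {a b a₀ b₀ : ObjGrid M}
    (h : (fun i => ((a i : ℕ) : ℤ) - (b i : ℕ)) = fun i => ((a₀ i : ℕ) : ℤ) - (b₀ i : ℕ)) :
    pixelCode a + (∏ i, (M i + 1) - pixelCode b) =
      pixelCode a₀ + (∏ i, (M i + 1) - pixelCode b₀) := by
  have h1 : pixelCode a + pixelCode b₀ = pixelCode a₀ + pixelCode b := by
    simp only [pixelCode, finPiFinEquiv_apply, ← Finset.sum_add_distrib, ← add_mul]
    refine Finset.sum_congr rfl fun i _ => ?_
    have := congrFun h i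
    congr 1
    omega
  have h2 := pixelCode_le b
  have h3 := pixelCode_le b₀
  omega

/-- Orthogonality isolates the pairs with a given difference: their coefficients sum to zero and
they share one exponent. -/
theorem sum_C_mul_X_pow_eq_zero (h : ObjGrid M × ObjGrid M → ℂ)
    (hh : ∀ p : FreqGrid M, ∑ x, h x *
      (oversampledDFT M p x.1 * star (oversampledDFT M p x.2)) = 0) :
    ∑ x, C (h x) * X ^ (pixelCode x.1 + (∏ i, (M i + 1) - pixelCode x.2)) = 0 := by
  classical
  set s : ObjGrid M × ObjGrid M → Fin d → ℤ :=
    fun x i => ((x.1 i : ℕ) : ℤ) - (x.2 i : ℕ) with hs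
  rw [← Finset.sum_fiberwise_of_maps_to (g := s) (t := Finset.univ.image s)
    fun x _ => Finset.mem_image_of_mem s (Finset.mem_univ x)]
  refine Finset.sum_eq_zero fun v hv => ?_
  obtain ⟨y, -, rfl⟩ := Finset.mem_image.1 hv
  have hfiber : ∑ x with s x = s y, h x = 0 := by
    have h1 : ∑ p : FreqGrid M, (∑ x, h x *
        (oversampledDFT M p x.1 * star (oversampledDFT M p x.2))) *
        (star (oversampledDFT M p y.1) * oversampledDFT M p y.2) = 0 :=
      Finset.sum_eq_zero fun p _ => by rw [hh p, zero_mul]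
    simp only [Finset.sum_mul] at h1
    rw [Finset.sum_comm] at h1
    simp only [mul_assoc (h _), ← Finset.mul_sum, sum_oversampledDFT] at h1
    simp only [mul_ite, mul_zero] at h1
    rw [← Finset.sum_filter, ← Finset.sum_mul] at h1
    refine (mul_eq_zero.1 h1).resolve_right (Finset.prod_ne_zero_iff.2 fun i _ => ?_)
    exact_mod_cast (Nat.succ_ne_zero (2 * M i))
  calc _ = ∑ x with s x = s y, C (h x) *
        X ^ (pixelCode y.1 + (∏ i, (M i + 1) - pixelCode y.2)) := by
        refine Finset.sum_congr rfl fun x hx => ?_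
        rw [pixelCode_add_eq (Finset.mem_filter.1 hx).2]
    _ = 0 := by rw [← Finset.sum_mul, ← map_sum, hfiber, C_0, zero_mul]

/-- A bilinear relation between Fourier transforms on the oversampled frequency grid is a relation
between generating polynomials. -/
theorem genPoly_relation (f g f' g' : ObjGrid M → ℂ)
    (h : ∀ p : FreqGrid M,
      (∑ a, f a * oversampledDFT M p a) * (∑ b, g' b * star (oversampledDFT M p b)) +
      (∑ b, f' b * star (oversampledDFT M p b)) * (∑ a, g a * oversampledDFT M p a) = 0) :
    genPoly pixelCode f * genPoly (fun n => ∏ i, (M i + 1) - pixelCode n) g' +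
      genPoly (fun n => ∏ i, (M i + 1) - pixelCode n) f' * genPoly pixelCode g = 0 := by
  rw [← sum_C_mul_X_pow_eq_zero (M := M) (fun x => f x.1 * g' x.2 + f' x.2 * g x.1) fun p => ?_]
  · rw [mul_comm (genPoly _ f')]
    simp only [genPoly, Fintype.sum_mul_sum, ← Finset.sum_add_distrib, Fintype.sum_prod_type]
    refine Finset.sum_congr rfl fun a _ => Finset.sum_congr rfl fun b _ => ?_
    rw [map_add, map_mul, map_mul, pow_add]
    ring
  · rw [← h p, mul_comm (∑ b, f' b * _)]
    simp only [Fintype.sum_mul_sum, ← Finset.sum_add_distrib, Fintype.sum_prod_type]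
    refine Finset.sum_congr rfl fun a _ => Finset.sum_congr rfl fun b _ => ?_
    ring

end Fourier

/-! ### Zero sets of polynomials are null -/

section GenericPolynomial

/-- Induction: as a polynomial in the first variable, q has a leading coefficient that is almost
surely nonzero at the remaining variables; the first variable must then avoid finitely many roots.
-/
theorem MvPolynomial.ae_eval_ne_zero_pi {n : ℕ} (ρ : Fin n → Measure ℂ)
    [∀ i, IsProbabilityMeasure (ρ i)] (hρ : ∀ i z, ρ i {z} = 0)
    {q : MvPolynomial (Fin n) ℂ} (hq : q ≠ 0) :
    Measure.pi ρ {x | MvPolynomial.eval x q = 0} = 0 := by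
  induction n with
  | zero =>
    have : {x : Fin 0 → ℂ | MvPolynomial.eval x q = 0} = ∅ := by
      ext x
      simp only [Set.mem_ofPred_eq, Set.mem_empty_iff_false, iff_false]
      intro h
      apply hq
      rw [MvPolynomial.eq_C_of_isEmpty q] at h ⊢
      rw [MvPolynomial.eval_C] at h
      rw [h, map_zero]
    rw [this, measure_empty]
  | succ n ih =>
    set r := MvPolynomial.finSuccEquiv ℂ n q with hr
    have hr0 : r ≠ 0 := by
      rw [hr, Ne, EmbeddingLike.map_eq_zero_iff]; exact hq
    have htail := ih (fun i => ρ i.succ) (fun i z => hρ _ z)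
      (Polynomial.leadingCoeff_ne_zero.2 hr0)
    have hmp := (measurePreserving_piFinSuccAbove ρ 0).symm
    have hmeas : MeasurableSet {x : Fin (n + 1) → ℂ | MvPolynomial.eval x q = 0} :=
      (isClosed_eq (MvPolynomial.continuous_eval q) continuous_const).measurableSet
    rw [← hmp.measure_preimage hmeas.nullMeasurableSet,
      Measure.prod_apply_symm (hmp.measurable hmeas), lintegral_eq_zero_iff' (by
        exact (measurable_measure_prodMk_right (hmp.measurable hmeas)).aemeasurable)]
    have hae : ∀ᵐ s ∂(Measure.pi fun i => ρ (Fin.succAbove 0 i)),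
        MvPolynomial.eval s r.leadingCoeff ≠ 0 := by
      rw [ae_iff]; simpa using htail
    filter_upwards [hae] with s hs
    have hne : r.map (MvPolynomial.eval s) ≠ 0 := by
      intro h0
      apply hs
      have := congrArg (fun w => Polynomial.coeff w r.natDegree) h0
      simpa [Polynomial.coeff_map] using this
    refine measure_mono_null (t := ((r.map (MvPolynomial.eval s)).roots.toFinset : Set ℂ))
      (fun y hy => ?_) ?_
    · have hy' : MvPolynomial.eval (Fin.cons y s) q = 0 := by
        simpa [MeasurableEquiv.piFinSuccAbove, Fin.consEquiv] using hy
      rw [MvPolynomial.eval_eq_eval_mv_eval'] at hy'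
      simp only [Finset.mem_coe, Multiset.mem_toFinset]
      rw [Polynomial.mem_roots hne]
      exact hy'
    · have : NullSingletonClass (ρ 0) := ⟨hρ 0⟩
      exact Finset.measure_zero _ _

theorem MvPolynomial.ae_eval_ne_zero {Ω ι : Type*} [MeasurableSpace Ω] [Fintype ι]
    {P : Measure Ω} [IsProbabilityMeasure P] {X : ι → Ω → ℂ} (hX : ∀ i, Measurable (X i))
    (hind : iIndepFun X P) (hcont : ∀ i z, P {ω | X i ω = z} = 0)
    {q : MvPolynomial ι ℂ} (hq : q ≠ 0) :
    ∀ᵐ ω ∂P, MvPolynomial.eval (fun i => X i ω) q ≠ 0 := by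
  let e := Fintype.equivFin ι
  have hind' := hind.precomp e.symm.injective
  have hlaw := (iIndepFun_iff_map_fun_eq_pi_map
    (fun i => (hX (e.symm i)).aemeasurable)).1 hind'
  have : ∀ i, IsProbabilityMeasure (Measure.map (X (e.symm i)) P) :=
    fun i => Measure.isProbabilityMeasure_map (hX _).aemeasurable
  have h0 := MvPolynomial.ae_eval_ne_zero_pi (fun i => Measure.map (X (e.symm i)) P)
    (fun i z => by
      rw [Measure.map_apply (hX _) (measurableSet_singleton z)]
      exact hcont _ z)
    (q := MvPolynomial.rename e q)
    (fun h => hq (MvPolynomial.rename_injective e e.injective (by rw [h, map_zero])))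
  rw [ae_iff]
  simp only [not_not]
  rw [← hlaw, Measure.map_apply (measurable_pi_lambda _ fun i => hX _)
    (isClosed_eq (MvPolynomial.continuous_eval _) continuous_const).measurableSet] at h0
  convert h0 using 2
  ext ω
  simp [MvPolynomial.eval_rename, Function.comp_def]

end GenericPolynomial

/-! ### Almost sure injectivity of the phase system -/

section GramDet

variable {m n : Type*} [Fintype m] [Fintype n] [DecidableEq n]

open scoped ComplexOrder in
theorem det_conjTranspose_mul_self_ne_zero_iff (A : Matrix m n ℂ) :
    (Aᴴ * A).det ≠ 0 ↔ ∀ v, A *ᵥ v = 0 → v = 0 := by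
  constructor
  · intro h v hv
    refine Matrix.eq_zero_of_mulVec_eq_zero h ?_
    rw [← Matrix.mulVec_mulVec, hv, Matrix.mulVec_zero]
  · intro h h0
    obtain ⟨v, hv, hv0⟩ := Matrix.exists_mulVec_eq_zero_iff.2 h0
    refine hv (h v ?_)
    exact (Matrix.conjTranspose_mul_self_mulVec_eq_zero A v).1 hv0

end GramDet

section PhaseSystem

variable {d : ℕ} {M : Fin d → ℕ}

/-- The coefficients of the bilinear phase relation at the frequency `p`, for the mask `μ`, as a
linear form in the pair `(f, f')`. The inverse of the mask is replaced by its cofactors. -/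
noncomputable def maskRow {R : Type*} [CommRing R] [Algebra ℂ R] (g : ObjGrid M → ℂ) (μ : ObjGrid M → R)
    (p : FreqGrid M) : ObjGrid M ⊕ ObjGrid M → R :=
  Sum.elim
    (fun a => algebraMap ℂ R (oversampledDFT M p a) * μ a *
      ∑ b, algebraMap ℂ R (star (g b) * star (oversampledDFT M p b)) *
        ∏ m ∈ Finset.univ.erase b, μ m)
    (fun b => algebraMap ℂ R (star (oversampledDFT M p b)) * (∏ m ∈ Finset.univ.erase b, μ m) *
      ∑ a, algebraMap ℂ R (g a * oversampledDFT M p a) * μ a)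

/-- The phase relations of two masks `μ`, `ν`, and the normalization `f p₀ = 0`. -/
noncomputable def phaseSystem {R : Type*} [CommRing R] [Algebra ℂ R] (g : ObjGrid M → ℂ) (p₀ : ObjGrid M)
    (μ ν : ObjGrid M → R) :
    Matrix (FreqGrid M ⊕ FreqGrid M ⊕ Unit) (ObjGrid M ⊕ ObjGrid M) R :=
  Matrix.of (Sum.elim (maskRow g μ) (Sum.elim (maskRow g ν)
    fun _ => Sum.elim (Pi.single p₀ 1) 0))

/-- Allows the system with an indeterminate mask to be evaluated at concrete masks. -/
theorem phaseSystem_map {R S : Type*} [CommRing R] [Algebra ℂ R] [CommRing S] [Algebra ℂ S]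
    (φ : R →ₐ[ℂ] S) (g : ObjGrid M → ℂ) (p₀ : ObjGrid M) (μ ν : ObjGrid M → R) :
    (phaseSystem g p₀ μ ν).map φ =
      phaseSystem g p₀ (fun m => φ (μ m)) (fun m => φ (ν m)) := by
  ext (p | p | u) (a | b)
  · simp [phaseSystem, maskRow]
  · simp [phaseSystem, maskRow]
  · simp [phaseSystem, maskRow]
  · simp [phaseSystem, maskRow]
  · simp [phaseSystem, Pi.single_apply, apply_ite φ]
  · simp [phaseSystem]

theorem maskRow_dotProduct (g : ObjGrid M → ℂ) {μ : ObjGrid M → ℂ} (hμ : ∀ m, μ m ≠ 0)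
    (p : FreqGrid M) (f f' : ObjGrid M → ℂ) :
    maskRow g μ p ⬝ᵥ Sum.elim f f' = (∏ m, μ m) *
      ((∑ a, f a * μ a * oversampledDFT M p a) *
        (∑ b, star (g b) * (μ b)⁻¹ * star (oversampledDFT M p b)) +
      (∑ b, f' b * (μ b)⁻¹ * star (oversampledDFT M p b)) *
        (∑ a, g a * μ a * oversampledDFT M p a)) := by
  have hcof : ∀ b, ∏ m ∈ Finset.univ.erase b, μ m = (∏ m, μ m) * (μ b)⁻¹ := by
    intro b
    rw [← Finset.prod_erase_mul _ _ (Finset.mem_univ b), mul_assoc, mul_inv_cancel₀ (hμ b),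
      mul_one]
  simp only [dotProduct, Fintype.sum_sum_type, Sum.elim_inl, Sum.elim_inr, maskRow, hcof,
    Algebra.algebraMap_self_apply]
  rw [mul_add]
  congr 1
  · rw [Finset.sum_mul, Finset.mul_sum]
    refine Finset.sum_congr rfl fun a _ => ?_
    rw [Finset.mul_sum, Finset.mul_sum, Finset.mul_sum, Finset.sum_mul]
    refine Finset.sum_congr rfl fun b _ => ?_
    ring
  · rw [Finset.sum_mul, Finset.mul_sum]
    refine Finset.sum_congr rfl fun a _ => ?_
    rw [Finset.mul_sum, Finset.mul_sum, Finset.mul_sum, Finset.sum_mul]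
    refine Finset.sum_congr rfl fun b _ => ?_
    ring

theorem phaseSystem_mulVec_eq_zero_iff (g : ObjGrid M → ℂ) (p₀ : ObjGrid M)
    {μ ν : ObjGrid M → ℂ} (hμ : ∀ m, μ m ≠ 0) (hν : ∀ m, ν m ≠ 0) (f f' : ObjGrid M → ℂ) :
    phaseSystem g p₀ μ ν *ᵥ Sum.elim f f' = 0 ↔ f p₀ = 0 ∧
      ∀ η, η = μ ∨ η = ν → ∀ p, (∑ a, f a * η a * oversampledDFT M p a) *
        (∑ b, star (g b) * (η b)⁻¹ * star (oversampledDFT M p b)) +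
      (∑ b, f' b * (η b)⁻¹ * star (oversampledDFT M p b)) *
        (∑ a, g a * η a * oversampledDFT M p a) = 0 := by
  have h1 : ∀ η : ObjGrid M → ℂ, (∀ m, η m ≠ 0) → ∀ p,
      maskRow g η p ⬝ᵥ Sum.elim f f' = 0 ↔ (∑ a, f a * η a * oversampledDFT M p a) *
        (∑ b, star (g b) * (η b)⁻¹ * star (oversampledDFT M p b)) +
      (∑ b, f' b * (η b)⁻¹ * star (oversampledDFT M p b)) *
        (∑ a, g a * η a * oversampledDFT M p a) = 0 := fun η hη p => by
    rw [maskRow_dotProduct g hη, mul_eq_zero,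
      or_iff_right (Finset.prod_ne_zero_iff.2 fun m _ => hη m)]
  have h2 : (Sum.elim (Pi.single p₀ 1) 0 : ObjGrid M ⊕ ObjGrid M → ℂ) ⬝ᵥ Sum.elim f f' = f p₀ := by
    simp [dotProduct, Pi.single_apply]
  rw [funext_iff]
  constructor
  · intro h
    refine ⟨h2 ▸ h (Sum.inr (Sum.inr ())), ?_⟩
    rintro η (rfl | rfl) p
    · exact (h1 _ hμ p).1 (h (Sum.inl p))
    · exact (h1 _ hν p).1 (h (Sum.inr (Sum.inl p)))
  · rintro ⟨h0, h⟩ (p | p | u)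
    · exact (h1 _ hμ p).2 (h _ (Or.inl rfl) p)
    · exact (h1 _ hν p).2 (h _ (Or.inr rfl) p)
    · exact h2.trans h0

/-- The mask is ν with its entry at p₀ multiplied by t. It need not be unimodular, since it only
witnesses that a polynomial is nonzero. -/
theorem exists_phaseSystem_injective {g : ObjGrid M → ℂ}
    (hcard : ∀ a b, ∃ m, g m ≠ 0 ∧ m ≠ a ∧ m ≠ b) {p₀ : ObjGrid M} (hg : g p₀ ≠ 0)
    (hp₀ : ∀ m, g m ≠ 0 → pixelCode m ≤ pixelCode p₀) {ν : ObjGrid M → ℂ}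
    (hν : ∀ m, ν m ≠ 0) :
    ∃ μ : ObjGrid M → ℂ, ∀ v, phaseSystem g p₀ μ ν *ᵥ v = 0 → v = 0 := by
  obtain ⟨t, ht0, ht⟩ := exists_unique_mask (e := pixelCode) (K := ∏ i, (M i + 1))
    (g := fun m => g m * ν m) (g' := fun m => star (g m) * (ν m)⁻¹) (p := p₀)
    pixelCode_injective pixelCode_le (fun m => by simp [hν m]) (mul_ne_zero hg (hν _))
    (fun m hm => hp₀ m (left_ne_zero_of_mul hm))
    (fun a b => by
      obtain ⟨m, hm, h⟩ := hcard a b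
      exact ⟨m, mul_ne_zero hm (hν m), h⟩)
  have hμ : ∀ m, (ν m * if m = p₀ then t else 1) ≠ 0 := fun m =>
    mul_ne_zero (hν m) (by split_ifs <;> simp [ht0])
  have hinv : ∀ m, (if m = p₀ then t else 1)⁻¹ = if m = p₀ then t⁻¹ else 1 := fun m => by
    split_ifs <;> simp
  refine ⟨fun m => ν m * if m = p₀ then t else 1, fun v hv => ?_⟩
  obtain ⟨f, f', rfl⟩ : ∃ f f', v = Sum.elim f f' :=
    ⟨v ∘ Sum.inl, v ∘ Sum.inr, (Sum.elim_comp_inl_inr v).symm⟩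
  obtain ⟨h0, h⟩ := (phaseSystem_mulVec_eq_zero_iff g p₀ hμ hν f f').1 hv
  have h1 := genPoly_relation _ _ _ _ (h _ (Or.inr rfl))
  have h2 := genPoly_relation _ _ _ _ (h _ (Or.inl rfl))
  simp only [mul_inv, hinv, ← mul_assoc] at h2
  obtain ⟨hf, hf'⟩ := ht (fun m => f m * ν m) (fun m => f' m * (ν m)⁻¹) (by simp [h0]) h1 h2
  ext (m | m)
  · simpa [hν m] using congrFun hf m
  · simpa [hν m] using congrFun hf' m

theorem continuous_phaseSystem (g : ObjGrid M → ℂ) (p₀ : ObjGrid M) :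
    Continuous fun x : (ObjGrid M → ℂ) × (ObjGrid M → ℂ) => phaseSystem g p₀ x.1 x.2 := by
  refine continuous_matrix ?_
  rintro (p | p | u) (a | b)
  all_goals simp only [phaseSystem, maskRow, Matrix.of_apply, Sum.elim_inl, Sum.elim_inr]
  all_goals fun_prop

/-- Independence makes the joint law a product, so by Fubini the second mask may be fixed. -/
theorem ae_phaseSystem_injective {Ω : Type*} [MeasurableSpace Ω] {P : Measure Ω}
    [IsProbabilityMeasure P] {g : ObjGrid M → ℂ}
    (hcard : ∀ a b, ∃ m, g m ≠ 0 ∧ m ≠ a ∧ m ≠ b) {p₀ : ObjGrid M} (hg : g p₀ ≠ 0)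
    (hp₀ : ∀ m, g m ≠ 0 → pixelCode m ≤ pixelCode p₀) {μ ν : Ω → ObjGrid M → ℂ}
    (hμ : ∀ n, Measurable fun ω => μ ω n) (hν : ∀ n, Measurable fun ω => ν ω n)
    (hν0 : ∀ ω m, ν ω m ≠ 0)
    (hind : iIndepFun (fun (n : ObjGrid M) (ω : Ω) => μ ω n) P)
    (hcont : ∀ n z, P {ω | μ ω n = z} = 0) (hpair : IndepFun μ ν P) :
    ∀ᵐ ω ∂P, ∀ v, phaseSystem g p₀ (μ ω) (ν ω) *ᵥ v = 0 → v = 0 := by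
  have hμm : Measurable μ := measurable_pi_lambda _ hμ
  have hνm : Measurable ν := measurable_pi_lambda _ hν
  set B : Set ((ObjGrid M → ℂ) × (ObjGrid M → ℂ)) :=
    {x | ((phaseSystem g p₀ x.2 x.1)ᴴ * phaseSystem g p₀ x.2 x.1).det = 0} with hB
  have hBm : MeasurableSet B := by
    refine (isClosed_eq ?_ continuous_const).measurableSet
    have h := (continuous_phaseSystem g p₀).comp continuous_swap
    exact (h.matrix_conjTranspose.matrix_mul h).matrix_det
  have hlaw := (indepFun_iff_map_prod_eq_prod_map_map hνm.aemeasurable hμm.aemeasurable).1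
    hpair.symm
  have hfixed : ∀ ν' : ObjGrid M → ℂ, (∀ m, ν' m ≠ 0) →
      Measure.map μ P (Prod.mk ν' ⁻¹' B) = 0 := by
    intro ν' hν'
    obtain ⟨μ', hμ'⟩ := exists_phaseSystem_injective hcard hg hp₀ hν'
    -- Conjugating the system at the fixed mask μ', not at the indeterminate one, keeps q
    -- polynomial; at μ' itself q is a Gram determinant.
    set q : MvPolynomial (ObjGrid M) ℂ :=
      ((phaseSystem g p₀ μ' ν')ᴴ.map (algebraMap ℂ (MvPolynomial (ObjGrid M) ℂ)) *
        phaseSystem g p₀ MvPolynomial.X (fun m => MvPolynomial.C (ν' m))).det with hq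
    have heval : ∀ η : ObjGrid M → ℂ, MvPolynomial.eval η q =
        ((phaseSystem g p₀ μ' ν')ᴴ * phaseSystem g p₀ η ν').det := by
      intro η
      rw [hq, RingHom.map_det, RingHom.mapMatrix_apply, Matrix.map_mul]
      congr 2
      · ext i j
        simp
      · have := phaseSystem_map (MvPolynomial.aeval η : MvPolynomial (ObjGrid M) ℂ →ₐ[ℂ] ℂ)
          g p₀ MvPolynomial.X (fun m => MvPolynomial.C (ν' m))
        simp only [MvPolynomial.aeval_X, MvPolynomial.aeval_C, Algebra.algebraMap_self_apply]
          at this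
        rw [← this]
        ext i j
        simp [MvPolynomial.aeval_eq_eval]
    have hq0 : q ≠ 0 := by
      intro h0
      have h1 := heval μ'
      rw [h0, map_zero] at h1
      exact (det_conjTranspose_mul_self_ne_zero_iff _).2 hμ' h1.symm
    have hae := MvPolynomial.ae_eval_ne_zero hμ hind hcont hq0
    rw [Measure.map_apply hμm (measurable_prodMk_left hBm)]
    refine measure_mono_null (fun ω hω => ?_) hae
    simp only [Set.mem_compl_iff, Set.mem_ofPred_eq, not_not]
    by_contra hne
    rw [heval] at hne
    refine (det_conjTranspose_mul_self_ne_zero_iff (phaseSystem g p₀ (μ ω) ν')).2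
      (fun v hv => ?_) hω
    refine Matrix.eq_zero_of_mulVec_eq_zero hne ?_
    rw [← Matrix.mulVec_mulVec, hv, Matrix.mulVec_zero]
  have hnull : (Measure.map ν P).prod (Measure.map μ P) B = 0 := by
    rw [Measure.measure_prod_null hBm]
    have hms : MeasurableSet {ν' : ObjGrid M → ℂ | ∀ m, ν' m ≠ 0} := by
      have : {ν' : ObjGrid M → ℂ | ∀ m, ν' m ≠ 0} = ⋂ m, {ν' | ν' m ≠ 0} := by
        ext; simp
      rw [this]
      exact MeasurableSet.iInter fun m =>
        (measurableSet_eq_fun (measurable_pi_apply m) measurable_const).compl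
    have hae : ∀ᵐ ν' ∂(Measure.map ν P), ∀ m, ν' m ≠ 0 :=
      (ae_map_iff hνm.aemeasurable hms).2 (Filter.Eventually.of_forall hν0)
    filter_upwards [hae] with ν' h
    exact hfixed ν' h
  rw [← hlaw, Measure.map_apply (hνm.prodMk hμm) hBm] at hnull
  filter_upwards [measure_eq_zero_iff_ae_notMem.1 hnull] with ω hω
  exact (det_conjTranspose_mul_self_ne_zero_iff _).1 hω

end PhaseSystem

/-! ### Rigidity of phases for the propagation matrix -/

section Rigidity

variable {d : ℕ} {M : Fin d → ℕ}

/-- A support contained in two points would be collinear. -/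
theorem RankGeTwo.exists_third_pixel {x : EuclideanSpace ℂ (ObjGrid M)} (hx : RankGeTwo x)
    (a b : ObjGrid M) : ∃ m, x m ≠ 0 ∧ m ≠ a ∧ m ≠ b := by
  by_contra! h
  set φ : ObjGrid M → Fin d → ℝ := fun n i => ((n i : ℕ) : ℝ) with hφ
  have hsub : objSupport x ⊆ {φ a, φ b} := by
    rintro _ ⟨m, hm, rfl⟩
    by_cases hma : m = a
    · exact Or.inl (by rw [hma])
    · exact Or.inr (by rw [h m hm hma]; rfl)
  have h1 : vectorSpan ℝ (convexHull ℝ (objSupport x)) = vectorSpan ℝ (objSupport x) := by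
    rw [← direction_affineSpan, affineSpan_convexHull, direction_affineSpan]
  have h2 : Module.finrank ℝ (vectorSpan ℝ (objSupport x)) ≤ 1 :=
    ((collinear_pair ℝ (φ a) (φ b)).subset hsub).finrank_le_one
  have h3 : 2 ≤ Module.finrank ℝ (vectorSpan ℝ (convexHull ℝ (objSupport x))) := hx
  rw [h1] at h3
  omega

theorem mul_star_add_star_mul_eq_zero {z w : ℂ} (h : (z / w).re = 0) :
    z * star w + star z * w = 0 := by
  by_cases hw : w = 0
  · simp [hw]
  · obtain ⟨q, rfl⟩ : ∃ q, z = q * w := ⟨z / w, (div_mul_cancel₀ _ hw).symm⟩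
    rw [mul_div_assoc, div_self hw, mul_one] at h
    have hq : q + star q = 0 := by
      apply Complex.ext <;> simp [h]
    rw [star_mul']
    linear_combination w * star w * hq

variable {ℓ : ℕ} {c : ℂ} {μ : Fin ℓ → ObjGrid M → ℂ}

theorem ne_zero_of_isIsometric_propagation (h : IsIsometric (propagation M c μ)) : c ≠ 0 := by
  rintro rfl
  have h0 : propagation M 0 μ = 0 := by
    ext
    simp [propagation]
  rw [IsIsometric, h0, Matrix.mul_zero] at h
  have := congrFun (congrFun h (fun _ => 0)) (fun _ => 0)
  simp at this

theorem propagation_apply (x : EuclideanSpace ℂ (ObjGrid M)) (j : Fin ℓ) (p : FreqGrid M) :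
    (propagation M c μ).toEuclideanLin x (j, p) =
      c * ∑ n, x n * μ j n * oversampledDFT M p n := by
  simp only [Matrix.toLpLin_apply, Matrix.mulVec, dotProduct, propagation, Matrix.of_apply,
    Matrix.smul_apply, Matrix.mul_diagonal, smul_eq_mul, Finset.mul_sum]
  refine Finset.sum_congr rfl fun n _ => ?_
  ring

theorem hasRigidPhase_propagation (hc : c ≠ 0) (hμ : ∀ j n, ‖μ j n‖ = 1) (i j : Fin ℓ)
    {x₀ : EuclideanSpace ℂ (ObjGrid M)} {p₀ : ObjGrid M} (hp₀ : x₀ p₀ ≠ 0)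
    (h : ∀ v, phaseSystem x₀ p₀ (μ i) (μ j) *ᵥ v = 0 → v = 0) :
    HasRigidPhase (propagation M c μ) x₀ := by
  intro u hu
  have hμ0 : ∀ j n, μ j n ≠ 0 := fun j n h0 => by
    have := hμ j n
    rw [h0, norm_zero] at this
    exact zero_ne_one this
  have hinv : ∀ j n, (μ j n)⁻¹ = star (μ j n) := fun j n => by
    rw [Complex.inv_def, Complex.normSq_eq_norm_sq, hμ]
    simp
  -- The pair (k x₀, -k conj x₀) solves the relations for every mask; subtracting it from (u, conj
  -- u) makes the first component vanish at p₀.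
  set k := u p₀ / x₀ p₀ with hk
  have hsol := h (Sum.elim (fun n => u n - k * x₀ n) fun n => star (u n) + k * star (x₀ n))
    ((phaseSystem_mulVec_eq_zero_iff x₀ p₀ (hμ0 i) (hμ0 j) _ _).2 ⟨by
      rw [hk, div_mul_cancel₀ _ hp₀, sub_self], fun η hη p => by
      obtain ⟨s, rfl⟩ : ∃ s, η = μ s := hη.elim (fun h => ⟨i, h⟩) fun h => ⟨j, h⟩
      have h1 := mul_star_add_star_mul_eq_zero (hu (s, p))
      rw [propagation_apply, propagation_apply] at h1
      set U := ∑ n, u n * μ s n * oversampledDFT M p n with hU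
      set G := ∑ n, x₀ n * μ s n * oversampledDFT M p n with hG
      have hUs : ∑ n, star (u n) * (μ s n)⁻¹ * star (oversampledDFT M p n) = star U := by
        simp only [hU, star_sum, star_mul', hinv]
      have hGs : ∑ n, star (x₀ n) * (μ s n)⁻¹ * star (oversampledDFT M p n) = star G := by
        simp only [hG, star_sum, star_mul', hinv]
      have h2 : U * star G + star U * G = 0 := by
        have hcc : c * star c ≠ 0 := mul_ne_zero hc (star_ne_zero.2 hc)
        rw [star_mul', star_mul'] at h1
        refine mul_left_cancel₀ hcc ?_
        linear_combination h1
      simp only [sub_mul, add_mul, Finset.sum_sub_distrib, Finset.sum_add_distrib, mul_assoc k,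
        ← Finset.mul_sum]
      rw [hUs, hGs, ← hU, ← hG]
      linear_combination h2⟩)
  have hf : ∀ n, u n = k * x₀ n := fun n => by
    have := congrFun hsol (Sum.inl n)
    simpa [sub_eq_zero] using this
  have hf' : star (u p₀) + k * star (x₀ p₀) = 0 := congrFun hsol (Sum.inr p₀)
  -- With u = k x₀, the second component at p₀ gives conj k + k = 0.
  have hkre : k.re = 0 := by
    rw [hf p₀, star_mul', ← add_mul, mul_eq_zero, or_iff_left (star_ne_zero.2 hp₀)] at hf'
    have := congrArg Complex.re hf'
    simp at this
    exact this
  refine ⟨k.im, ?_⟩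
  ext n
  rw [hf n]
  have hkI : k = k.im * Complex.I := by
    apply Complex.ext <;> simp [hkre]
  rw [PiLp.smul_apply, PiLp.smul_apply, Complex.real_smul, smul_eq_mul, ← mul_assoc, ← hkI]

end Rigidity

/-! ### Conclusion -/

theorem mainTheorem5 {d ℓ : ℕ} (M : Fin d → ℕ) (hℓ : 2 ≤ ℓ)
    (x₀ : EuclideanSpace ℂ (ObjGrid M)) (hx₀ : RankGeTwo x₀)
    {Ω : Type*} [MeasurableSpace Ω] (P : Measure Ω) [IsProbabilityMeasure P]
    -- the phase masks `μ ω 1, …, μ ω ℓ`, random or deterministic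
    (μ : Ω → Fin ℓ → ObjGrid M → ℂ)
    (hmeas : ∀ j n, Measurable fun ω => μ ω j n)
    (hphase : ∀ ω j n, ‖μ ω j n‖ = 1)
    -- the entries of the mask `j₀` are independent and continuously distributed
    (j₀ : Fin ℓ)
    (hindep : iIndepFun (fun (n : ObjGrid M) (ω : Ω) => μ ω j₀ n) P)
    (hcont : ∀ n z, P {ω | μ ω j₀ n = z} = 0)
    -- every other mask is independent of the mask `j₀`
    (hother : ∀ j, j ≠ j₀ → IndepFun (fun ω => μ ω j₀) (fun ω => μ ω j) P)
    -- `c` is the normalization that makes `A^*` isometric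
    (c : ℂ) (hiso : ∀ ω, IsIsometric (propagation M c (μ ω))) :
    ∀ᵐ ω ∂P, ∃ γ : ℝ, 0 ≤ γ ∧ γ < 1 ∧ ∃ δ : ℝ, 0 < δ ∧
      -- FDR started from an object estimate `x^(1)`, that is, from `y^(1) = A^* x^(1)`
      (∀ (y : ℕ → EuclideanSpace ℂ (Fin ℓ × FreqGrid M))
          (x : ℕ → EuclideanSpace ℂ (ObjGrid M)),
        IsFDRSequence (propagation M c (μ ω)) x₀ y →
        (∀ k, x k = (propagation M c (μ ω))ᴴ.toEuclideanLin (y k)) →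
        y 1 = (propagation M c (μ ω)).toEuclideanLin (x 1) →
        ‖x 1 - x₀‖ < δ →
        ∀ k : ℕ, 1 ≤ k → ∃ α : ℂ, IsOptimalPhase (x k) x₀ α ∧
          ‖α • x k - x₀‖ ≤ γ ^ (k - 1) * ‖x 1 - x₀‖) ∧
      -- FDR started from an arbitrary `y^(1)` near `A^* x₀`
      (∀ (y : ℕ → EuclideanSpace ℂ (Fin ℓ × FreqGrid M))
          (x : ℕ → EuclideanSpace ℂ (ObjGrid M)),
        IsFDRSequence (propagation M c (μ ω)) x₀ y →
        (∀ k, x k = (propagation M c (μ ω))ᴴ.toEuclideanLin (y k)) →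
        ‖y 1 - (propagation M c (μ ω)).toEuclideanLin x₀‖ < δ →
        ∀ k : ℕ, 1 ≤ k → ∃ α : ℂ, IsOptimalPhase (x k) x₀ α ∧
          ‖α • x k - x₀‖ ≤
            γ ^ (k - 1) * ‖y 1 - (propagation M c (μ ω)).toEuclideanLin x₀‖) := by
  obtain ⟨j, hj⟩ : ∃ j : Fin ℓ, j ≠ j₀ := by
    have : Nontrivial (Fin ℓ) := Fin.nontrivial_iff_two_le.2 hℓ
    exact exists_ne j₀
  have hcard := hx₀.exists_third_pixel
  obtain ⟨p₀, hp₀, hmax⟩ : ∃ p₀, x₀ p₀ ≠ 0 ∧ ∀ m, x₀ m ≠ 0 → pixelCode m ≤ pixelCode p₀ := by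
    obtain ⟨m, hm, -⟩ := hcard (fun _ => 0) (fun _ => 0)
    obtain ⟨p₀, hp₀, hmax⟩ := Finset.exists_max_image
      (Finset.univ.filter fun m : ObjGrid M => x₀ m ≠ 0) pixelCode ⟨m, by simpa using hm⟩
    exact ⟨p₀, by simpa using hp₀, fun m hm => hmax m (by simpa using hm)⟩
  have hne : x₀ ≠ 0 := by
    rintro rfl
    exact hp₀ rfl
  have hν0 : ∀ ω m, μ ω j m ≠ 0 := fun ω m h0 => by
    have := hphase ω j m
    rw [h0, norm_zero] at this
    exact zero_ne_one this
  filter_upwards [ae_phaseSystem_injective hcard hp₀ hmax (hmeas j₀) (hmeas j) hν0 hindep hcont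
    (hother j hj)] with ω hω
  have hT := hiso ω
  have hrigid := hasRigidPhase_propagation (ne_zero_of_isIsometric_propagation hT) (hphase ω)
    j₀ j hp₀ hω
  obtain ⟨γ, h0, h1, δ, hδ, hconv⟩ := hT.exists_fdr_convergence hrigid hne
  refine ⟨γ, h0, h1, δ, hδ, fun y x hy hx hy1 hx1 k hk => ?_, fun y x hy hx hy1 k hk => ?_⟩
  -- Isometry of A* reduces the object-space start to the data-space estimate.
  · have hnorm : ‖y 1 - (propagation M c (μ ω)).toEuclideanLin x₀‖ = ‖x 1 - x₀‖ := by
      rw [hy1, ← map_sub, hT.norm_apply]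
    rw [hx k, ← hnorm]
    exact hconv y hy (hnorm ▸ hx1) k hk
  · rw [hx k]
    exact hconv y hy hy1 k hk
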